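/- Let $E$ be a complex Banach lattice, i.e. the complexification of a real Banach lattice $E_{\mathbb R}$, with modulus $|x+iy|=\sup_{\theta}(\cos\theta\,x+\sin\theta\,y)$ and norm $\|z\|=\|\,|z|\,\|$. Let $u\in E_+$ and let $E_u=\{x\in E:\ |x|\le cu\text{ for some }c>0\}$ be the principal ideal generated by $u$, with the gauge norm $\|x\|_{E_u}=\inf\{c>0:\ |x|\le cu\}$. An operator $A:\operatorname{dom}(A)\subseteq E\to E$ is called real if $\operatorname{dom}(A)=\operatorname{dom}(A)\cap E_{\mathbb R}+i\,\operatorname{dom}(A)\cap E_{\mathbb R}$ and $A(\operatorname{dom}(A)\cap E_{\mathbb R})\subseteq E_{\mathbb R}$. Let $(T(t))_{t\ge0}$ be an immediately differentiable $C_0$-semigroup on $E$ (all orbits are differentiable on $(0,\infty)$) with real generator $A$. For every $\kappa\in\mathbb C$ with $|\kappa|<1$ let $B(\kappa):\operatorname{dom}(A)\to E$ be linear and bounded with respect to the graph norm of $A$, with $B(0)=0$, with $B(\kappa)$ real for real $\kappa$, and put $A(\kappa)=A+B(\kappa)$ with domain $\operatorname{dom}(A)$. Suppose that $\kappa\mapsto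 A(\kappa)x$ is holomorphic on the open unit disc for every $x\in\operatorname{dom}(A)$, and that: 1. there are $C\ge1$ and $\alpha>0$ such that $T(t)E\subseteq E_u$ and $\|T(t)\|_{E\to E_u}\le Ct^{-\alpha}$ for all $t\in(0,1]$; 2. for each $\kappa$ there are $q\in(0,1)$ and $t_0>0$ with $\int_0^{t_0}\|B(\kappa)T(s)x\|\,ds\le q\|x\|$ for all $x\in\operatorname{dom}(A)$; 3. for each $\kappa$ there are $C\ge1$ and $\beta\in[0,1)$ such that, for all $t\in(0,1]$ and $x\in E_u$, one has $T(t)x\in E_u$ with $\|T(t)x\|_{E_u}\le C\|x\|_{E_u}$ and, whenever $T(t)x\in\operatorname{dom}(A)$, also $B(\kappa)T(t)x\in E_u$ with $\|B(\kappa)T(t)x\|_{E_u}\le Ct^{-\beta}\|x\|_{E_u}$. Let $\lambda_0\in\sigma(A)\cap\mathbb R$ be a pole of the resolvent $R(\cdot,A)=(\cdot-A)^{-1}$ and an algebraically simple eigenvalue of $A$ (i.e. $\bigcup_m\ker(\lambda_0-A)^m$ is one-dimensional) with an eigenvector $v_0$ satisfying $v_0\ge cu$ for some $c>0$. Let $r>0$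 be such that $[\lambda_0-r,\lambda_0+r]\cap\sigma(A)=\{\lambda_0\}$, and suppose that $$\beta_\kappa:=\sup_{\lambda\in\mathbb R,\ |\lambda-\lambda_0|=r}\|B(\kappa)R(\lambda,A)\|\to0\qquad\text{as }\kappa\to0\text{ in }\mathbb R .$$ Then there exists $\delta\in(0,1]$ such that for every $\kappa\in(-\delta,\delta)$ the operator $A(\kappa)$ has exactly one eigenvalue $\lambda(\kappa)$ in the open interval $(\lambda_0-r,\lambda_0+r)$, this eigenvalue is algebraically simple, and it has an eigenvector $v(\kappa)\in E_u$ with $v(\kappa)\ge\frac c2u$. -/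

import Mathlib

open Filter Topology Set

noncomputable section

/-! ## Complex Banach lattices

A real Banach lattice is a complete normed space `F` over `ℝ` with a lattice order that is
compatible with the vector space structure and whose norm is solid.  A complex Banach lattice is
the complexification `F ⊕ iF`, with modulus `|x + iy| = sup_θ (cos θ • x + sin θ • y)` and norm
`‖z‖ = ‖|z|‖`. -/

/-- The complexification `F ⊕ iF` of a real Banach lattice `F`. -/
@[ext]
structure LatticeCplx (F : Type*) where
  /-- real part -/
  re : F
  /-- imaginary part -/
  im : F

namespace LatticeCplx

section Algebra

variable {F : Type*} [AddCommGroup F]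

instance : Zero (LatticeCplx F) := ⟨⟨0, 0⟩⟩
instance : Add (LatticeCplx F) := ⟨fun z w => ⟨z.re + w.re, z.im + w.im⟩⟩
instance : Neg (LatticeCplx F) := ⟨fun z => ⟨-z.re, -z.im⟩⟩
instance : Sub (LatticeCplx F) := ⟨fun z w => ⟨z.re - w.re, z.im - w.im⟩⟩

@[simp] theorem zero_re : (0 : LatticeCplx F).re = 0 := rfl
@[simp] theorem zero_im : (0 : LatticeCplx F).im = 0 := rfl
@[simp] theorem add_re (z w : LatticeCplx F) : (z + w).re = z.re + w.re := rfl
@[simp] theorem add_im (z w : LatticeCplx F) : (z + w).im = z.im + w.im := rfl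
@[simp] theorem neg_re (z : LatticeCplx F) : (-z).re = -z.re := rfl
@[simp] theorem neg_im (z : LatticeCplx F) : (-z).im = -z.im := rfl
@[simp] theorem sub_re (z w : LatticeCplx F) : (z - w).re = z.re - w.re := rfl
@[simp] theorem sub_im (z w : LatticeCplx F) : (z - w).im = z.im - w.im := rfl

instance : AddCommGroup (LatticeCplx F) where
  add_assoc a b c := by ext <;> simp [add_assoc]
  zero_add a := by ext <;> simp
  add_zero a := by ext <;> simp
  add_comm a b := by ext <;> simp [add_comm]
  neg_add_cancel a := by ext <;> simp
  sub_eq_add_neg a b := by ext <;> simp [sub_eq_add_neg]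
  nsmul := nsmulRec
  zsmul := zsmulRec

variable [Module ℝ F]

instance : SMul ℂ (LatticeCplx F) :=
  ⟨fun a z => ⟨a.re • z.re - a.im • z.im, a.re • z.im + a.im • z.re⟩⟩

@[simp] theorem smul_re (a : ℂ) (z : LatticeCplx F) :
    (a • z).re = a.re • z.re - a.im • z.im := rfl
@[simp] theorem smul_im (a : ℂ) (z : LatticeCplx F) :
    (a • z).im = a.re • z.im + a.im • z.re := rfl

instance : Module ℂ (LatticeCplx F) where
  one_smul z := by ext <;> simp
  mul_smul a b z := by
    ext <;> simp only [smul_re, smul_im, Complex.mul_re, Complex.mul_im] <;> module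
  smul_zero a := by ext <;> simp
  smul_add a z w := by ext <;> simp only [smul_re, smul_im, add_re, add_im] <;> module
  add_smul a b z := by
    ext <;> simp only [smul_re, smul_im, add_re, add_im, Complex.add_re, Complex.add_im] <;> module
  zero_smul z := by ext <;> simp

/-- The inclusion of the real part `F` into its complexification. -/
def ofReal (x : F) : LatticeCplx F := ⟨x, 0⟩

end Algebra

/-- The order of the complexification: `z ≤ w` if and only if `w - z` lies in the positive cone
of the real part. -/
instance {F : Type*} [LE F] : LE (LatticeCplx F) := ⟨fun z w => z.re ≤ w.re ∧ z.im = w.im⟩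

section Modulus


variable {F : Type*} [NormedAddCommGroup F] [Lattice F] [HasSolidNorm F] [IsOrderedAddMonoid F]
  [NormedSpace ℝ F] [IsOrderedModule ℝ F]

theorem smul_le_smul_abs (a : ℝ) (x : F) : a • x ≤ |a| • |x| := by
  rcases le_total 0 a with ha | ha
  · rw [abs_of_nonneg ha]
    exact smul_le_smul_of_nonneg_left (le_abs_self x) ha
  · rw [abs_of_nonpos ha, ← neg_smul_neg]
    exact smul_le_smul_of_nonneg_left (neg_le_abs x) (neg_nonneg.2 ha)

/-- The vector `Re (e^{-iθ} (x + iy))`. -/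
def rot (x y : F) (θ : ℝ) : F := Real.cos θ • x + Real.sin θ • y

theorem rot_le (x y : F) (θ φ : ℝ) : rot x y θ ≤ rot x y φ + |θ - φ| • (|x| + |y|) := by
  have h1 : |Real.cos θ - Real.cos φ| ≤ |θ - φ| := by
    simpa [Real.dist_eq] using Real.lipschitzWith_cos.dist_le_mul θ φ
  have h2 : |Real.sin θ - Real.sin φ| ≤ |θ - φ| := by
    simpa [Real.dist_eq] using Real.lipschitzWith_sin.dist_le_mul θ φ
  have h3 : (Real.cos θ - Real.cos φ) • x ≤ |θ - φ| • |x| :=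
    (smul_le_smul_abs _ _).trans (smul_le_smul_of_nonneg_right h1 (abs_nonneg x))
  have h4 : (Real.sin θ - Real.sin φ) • y ≤ |θ - φ| • |y| :=
    (smul_le_smul_abs _ _).trans (smul_le_smul_of_nonneg_right h2 (abs_nonneg y))
  have h5 : rot x y θ = rot x y φ +
      ((Real.cos θ - Real.cos φ) • x + (Real.sin θ - Real.sin φ) • y) := by
    simp only [rot]; module
  rw [h5, smul_add]
  exact add_le_add_right (add_le_add h3 h4) _

theorem exists_isLUB_rot [CompleteSpace F] (x y : F) : ∃ m, IsLUB (range (rot x y)) m := by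
  set w : F := |x| + |y| with hw
  have hw0 : 0 ≤ w := add_nonneg (abs_nonneg x) (abs_nonneg y)
  let e : ℕ → ℝ := fun n => 2 * Real.pi / (n + 1)
  have he0 : ∀ n, 0 < e n := fun n => by have := Real.pi_pos; positivity
  let s : ℕ → F := fun n =>
    (Finset.range (n + 1)).sup' Finset.nonempty_range_add_one (fun k => rot x y (k * e n))
  have hub : ∀ n θ, rot x y θ ≤ s n + e n • w := by
    intro n θ
    have hper : Function.Periodic (rot x y) (2 * Real.pi) := fun t => by simp [rot]
    obtain ⟨t, ht, hEq⟩ := hper.exists_mem_Ico₀ (by have := Real.pi_pos; positivity) θ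
    rw [hEq]
    have hk0 : 0 ≤ t / e n := div_nonneg ht.1 (he0 n).le
    have hlo : (⌊t / e n⌋₊ : ℝ) * e n ≤ t := by
      rw [← le_div_iff₀ (he0 n)]; exact Nat.floor_le hk0
    have hhi : t < ((⌊t / e n⌋₊ : ℝ) + 1) * e n := by
      rw [← div_lt_iff₀ (he0 n)]; exact Nat.lt_floor_add_one _
    have hmem : ⌊t / e n⌋₊ ∈ Finset.range (n + 1) := by
      rw [Finset.mem_range, Nat.floor_lt hk0, div_lt_iff₀ (he0 n)]
      have : ((n + 1 : ℕ) : ℝ) * e n = 2 * Real.pi := by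
        simp only [e]; push_cast; field_simp
      rw [this]; exact ht.2
    refine (rot_le x y t (⌊t / e n⌋₊ * e n)).trans (add_le_add ?_ ?_)
    · exact Finset.le_sup' (fun k : ℕ => rot x y (k * e n)) hmem
    · refine smul_le_smul_of_nonneg_right ?_ hw0
      rw [abs_of_nonneg (by linarith)]
      linarith
  have hss : ∀ m n, s m ≤ s n + e n • w := fun m n =>
    Finset.sup'_le _ _ fun k _ => hub n _
  have hdist : ∀ m n N, N ≤ m → N ≤ n → dist (s m) (s n) ≤ e N * ‖w‖ := by
    intro m n N hm hn
    have hmono : ∀ p, N ≤ p → e p ≤ e N := fun p hp => by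
      have := Real.pi_pos
      have : (N : ℝ) ≤ p := by exact_mod_cast hp
      simp only [e]; gcongr
    have h1 : |s m - s n| ≤ e N • w := by
      rw [abs_le', neg_sub]
      refine ⟨sub_le_iff_le_add'.2 ((hss m n).trans ?_), sub_le_iff_le_add'.2 ((hss n m).trans ?_)⟩
      · exact add_le_add_right (smul_le_smul_of_nonneg_right (hmono n hn) hw0) _
      · exact add_le_add_right (smul_le_smul_of_nonneg_right (hmono m hm) hw0) _
    rw [dist_eq_norm]
    calc ‖s m - s n‖ ≤ ‖e N • w‖ := norm_le_norm_of_abs_le_abs (h1.trans (le_abs_self _))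
      _ = e N * ‖w‖ := by rw [norm_smul, Real.norm_of_nonneg (he0 N).le]
  have he : Tendsto e atTop (𝓝 0) := by
    simpa [e, div_eq_mul_inv] using
      (tendsto_one_div_add_atTop_nhds_zero_nat (𝕜 := ℝ)).const_mul (2 * Real.pi)
  have hc : CauchySeq s := cauchySeq_of_le_tendsto_0 (fun N => e N * ‖w‖)
    (fun m n N hm hn => hdist m n N hm hn) (by simpa using he.mul_const ‖w‖)
  obtain ⟨m, hm⟩ := cauchySeq_tendsto_of_complete hc
  refine ⟨m, ?_, ?_⟩
  · rintro _ ⟨θ, rfl⟩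
    have : Tendsto (fun n => s n + e n • w) atTop (𝓝 m) := by
      simpa using hm.add (he.smul_const w)
    exact ge_of_tendsto' this fun n => hub n θ
  · intro b hb
    exact le_of_tendsto' hm fun n => Finset.sup'_le _ _ fun k _ => hb ⟨_, rfl⟩

variable [CompleteSpace F]

/-- The modulus `|x + iy| = sup_θ (cos θ • x + sin θ • y)`, an element of `F`. -/
def modulus (z : LatticeCplx F) : F := (exists_isLUB_rot z.re z.im).choose

theorem isLUB_modulus (z : LatticeCplx F) : IsLUB (range (rot z.re z.im)) z.modulus :=
  (exists_isLUB_rot z.re z.im).choose_spec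

theorem rot_le_modulus (z : LatticeCplx F) (θ : ℝ) : rot z.re z.im θ ≤ z.modulus :=
  (isLUB_modulus z).1 ⟨θ, rfl⟩

theorem modulus_le {z : LatticeCplx F} {b : F} (h : ∀ θ, rot z.re z.im θ ≤ b) : z.modulus ≤ b :=
  (isLUB_modulus z).2 (by rintro _ ⟨θ, rfl⟩; exact h θ)

theorem abs_re_le (z : LatticeCplx F) : |z.re| ≤ z.modulus :=
  abs_le'.2 ⟨by simpa [rot] using rot_le_modulus z 0,
    by simpa [rot] using rot_le_modulus z Real.pi⟩

theorem abs_im_le (z : LatticeCplx F) : |z.im| ≤ z.modulus :=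
  abs_le'.2 ⟨by simpa [rot] using rot_le_modulus z (Real.pi / 2),
    by simpa [rot] using rot_le_modulus z (-(Real.pi / 2))⟩

theorem modulus_nonneg (z : LatticeCplx F) : 0 ≤ z.modulus := (abs_nonneg _).trans (abs_re_le z)

theorem modulus_le_add (z : LatticeCplx F) : z.modulus ≤ |z.re| + |z.im| := by
  refine modulus_le fun θ => add_le_add ?_ ?_
  · refine (smul_le_smul_abs _ _).trans ?_
    simpa using smul_le_smul_of_nonneg_right (Real.abs_cos_le_one θ) (abs_nonneg z.re)
  · refine (smul_le_smul_abs _ _).trans ?_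
    simpa using smul_le_smul_of_nonneg_right (Real.abs_sin_le_one θ) (abs_nonneg z.im)

theorem modulus_add_le (z w : LatticeCplx F) : (z + w).modulus ≤ z.modulus + w.modulus := by
  refine modulus_le fun θ => ?_
  have : rot (z + w).re (z + w).im θ = rot z.re z.im θ + rot w.re w.im θ := by
    simp only [rot, add_re, add_im]; module
  rw [this]
  exact add_le_add (rot_le_modulus z θ) (rot_le_modulus w θ)

theorem modulus_smul_le (a : ℂ) (z : LatticeCplx F) : (a • z).modulus ≤ ‖a‖ • z.modulus := by
  refine modulus_le fun θ => ?_
  have h : rot (a • z).re (a • z).im θ = ‖a‖ • rot z.re z.im (θ - a.arg) := by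
    have hr := Complex.norm_mul_cos_arg a
    have hi := Complex.norm_mul_sin_arg a
    simp only [rot, smul_re, smul_im, Real.cos_sub, Real.sin_sub]
    rw [← hr, ← hi]
    module
  rw [h]
  exact smul_le_smul_of_nonneg_left (rot_le_modulus z _) (norm_nonneg a)

theorem norm_le_of_le {x y : F} (hx : 0 ≤ x) (h : x ≤ y) : ‖x‖ ≤ ‖y‖ :=
  norm_le_norm_of_abs_le_abs (by rwa [abs_of_nonneg hx, abs_of_nonneg (hx.trans h)])

theorem norm_re_le_modulus (z : LatticeCplx F) : ‖z.re‖ ≤ ‖z.modulus‖ := by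
  rw [← norm_abs_eq_norm z.re]
  exact norm_le_of_le (abs_nonneg _) (abs_re_le z)

theorem norm_im_le_modulus (z : LatticeCplx F) : ‖z.im‖ ≤ ‖z.modulus‖ := by
  rw [← norm_abs_eq_norm z.im]
  exact norm_le_of_le (abs_nonneg _) (abs_im_le z)

theorem norm_modulus_le_add (z : LatticeCplx F) : ‖z.modulus‖ ≤ ‖z.re‖ + ‖z.im‖ := by
  rw [← norm_abs_eq_norm z.re, ← norm_abs_eq_norm z.im]
  exact (norm_le_of_le (modulus_nonneg z) (modulus_le_add z)).trans (norm_add_le _ _)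

theorem norm_modulus_smul_le (a : ℂ) (z : LatticeCplx F) :
    ‖(a • z).modulus‖ ≤ ‖a‖ * ‖z.modulus‖ := by
  have := norm_le_of_le (modulus_nonneg _) (modulus_smul_le a z)
  rwa [norm_smul, norm_norm] at this

instance : Norm (LatticeCplx F) := ⟨fun z => ‖z.modulus‖⟩

theorem normedSpaceCore : NormedSpace.Core ℂ (LatticeCplx F) where
  norm_nonneg z := norm_nonneg z.modulus
  norm_smul a z := by
    refine le_antisymm (norm_modulus_smul_le a z) ?_
    rcases eq_or_ne a 0 with rfl | ha
    · rw [norm_zero, zero_mul]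
      exact norm_nonneg ((0 : ℂ) • z).modulus
    · have h := norm_modulus_smul_le a⁻¹ (a • z)
      rw [smul_smul, inv_mul_cancel₀ ha, one_smul, norm_inv] at h
      have ha' : 0 < ‖a‖ := norm_pos_iff.2 ha
      rwa [inv_mul_eq_div, le_div_iff₀ ha', mul_comm] at h
  norm_triangle z w :=
    (norm_le_of_le (modulus_nonneg _) (modulus_add_le z w)).trans (norm_add_le _ _)
  norm_eq_zero_iff z := by
    change ‖z.modulus‖ = 0 ↔ z = 0
    constructor
    · intro h
      have h1 := norm_re_le_modulus z
      have h2 := norm_im_le_modulus z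
      rw [h] at h1 h2
      ext
      · exact norm_le_zero_iff.1 h1
      · exact norm_le_zero_iff.1 h2
    · rintro rfl
      exact le_antisymm (by simpa using norm_modulus_le_add (0 : LatticeCplx F)) (norm_nonneg _)

instance : NormedAddCommGroup (LatticeCplx F) := NormedAddCommGroup.ofCore normedSpaceCore

instance : NormedSpace ℂ (LatticeCplx F) where
  norm_smul_le a z := norm_modulus_smul_le a z

theorem norm_eq (z : LatticeCplx F) : ‖z‖ = ‖z.modulus‖ := rfl

theorem dist_eq (z w : LatticeCplx F) : dist z w = ‖(z - w).modulus‖ := by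
  rw [dist_eq_norm, norm_eq]

theorem dist_le_add (z w : LatticeCplx F) : dist z w ≤ ‖z.re - w.re‖ + ‖z.im - w.im‖ := by
  rw [dist_eq]
  exact norm_modulus_le_add (z - w)

instance : CompleteSpace (LatticeCplx F) := by
  refine Metric.complete_of_cauchySeq_tendsto fun s hs => ?_
  rw [Metric.cauchySeq_iff] at hs
  have hre : CauchySeq fun n => (s n).re := by
    rw [Metric.cauchySeq_iff]
    intro ε hε
    obtain ⟨N, hN⟩ := hs ε hε
    refine ⟨N, fun m hm n hn => lt_of_le_of_lt ?_ (hN m hm n hn)⟩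
    rw [dist_eq_norm, dist_eq]
    exact norm_re_le_modulus (s m - s n)
  have him : CauchySeq fun n => (s n).im := by
    rw [Metric.cauchySeq_iff]
    intro ε hε
    obtain ⟨N, hN⟩ := hs ε hε
    refine ⟨N, fun m hm n hn => lt_of_le_of_lt ?_ (hN m hm n hn)⟩
    rw [dist_eq_norm, dist_eq]
    exact norm_im_le_modulus (s m - s n)
  obtain ⟨x, hx⟩ := cauchySeq_tendsto_of_complete hre
  obtain ⟨y, hy⟩ := cauchySeq_tendsto_of_complete him
  refine ⟨⟨x, y⟩, ?_⟩
  rw [tendsto_iff_norm_sub_tendsto_zero] at hx hy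
  rw [tendsto_iff_dist_tendsto_zero]
  have h0 : Tendsto (fun n => ‖(s n).re - x‖ + ‖(s n).im - y‖) atTop (𝓝 0) := by
    simpa using hx.add hy
  exact squeeze_zero (fun n => dist_nonneg) (fun n => dist_le_add (s n) ⟨x, y⟩) h0

/-- The principal ideal `E_u = {z | |z| ≤ c u for some c > 0}`. -/
def principalIdeal (u : F) : Set (LatticeCplx F) := {z | ∃ c : ℝ, 0 < c ∧ z.modulus ≤ c • u}

/-- The gauge norm `inf {c > 0 | |z| ≤ c u}` of `E_u` (used for elements of `E_u` only). -/
def gaugeNorm (u : F) (z : LatticeCplx F) : ℝ := sInf {c : ℝ | 0 < c ∧ z.modulus ≤ c • u}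

end Modulus

/-- A partially defined operator on the complexification is real if its domain is the
complexification of the set of its real elements and it maps real elements to real elements. -/
def IsRealOp {F : Type*} [AddCommGroup F] [Module ℝ F]
    (A : LatticeCplx F →ₗ.[ℂ] LatticeCplx F) : Prop :=
  (∀ z ∈ A.domain, ofReal z.re ∈ A.domain ∧ ofReal z.im ∈ A.domain) ∧
    ∀ (x : F) (hx : ofReal x ∈ A.domain), (A ⟨ofReal x, hx⟩).im = 0

end LatticeCplx

/-! ## Unbounded operators: resolvent, poles, eigenvalues -/

namespace UnboundedOp

variable {E : Type*} [NormedAddCommGroup E] [NormedSpace ℂ E]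

/-- `R` is a bounded two-sided inverse of `μ - A : dom A → E`. -/
def IsResolventAt (A : E →ₗ.[ℂ] E) (μ : ℂ) (R : E →L[ℂ] E) : Prop :=
  (∀ y : E, ∃ h : R y ∈ A.domain, μ • R y - A ⟨R y, h⟩ = y) ∧
    ∀ x : A.domain, R (μ • (x : E) - A x) = x

/-- The resolvent set `ρ(A)`. -/
def resolventSet (A : E →ₗ.[ℂ] E) : Set ℂ := {μ | ∃ R : E →L[ℂ] E, IsResolventAt A μ R}

/-- The spectrum `σ(A)`. -/
def spectrum (A : E →ₗ.[ℂ] E) : Set ℂ := (resolventSet A)ᶜ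

open Classical in
/-- The resolvent `R(μ, A) = (μ - A)⁻¹` for `μ ∈ ρ(A)` (and `0` elsewhere). -/
def resolvent (A : E →ₗ.[ℂ] E) (μ : ℂ) : E →L[ℂ] E :=
  if h : μ ∈ resolventSet A then h.choose else 0

/-- `μ₀` is an isolated point of the spectrum at which the resolvent has a pole. -/
def IsPoleOfResolvent (A : E →ₗ.[ℂ] E) (μ₀ : ℂ) : Prop :=
  μ₀ ∈ spectrum A ∧ (∀ᶠ μ in 𝓝[≠] μ₀, μ ∈ resolventSet A) ∧
    MeromorphicAt (resolvent A) μ₀ ∧ meromorphicOrderAt (resolvent A) μ₀ < 0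

/-- `v` is an eigenvector of `A` for the eigenvalue `μ`. -/
def IsEigenvector (A : E →ₗ.[ℂ] E) (μ : ℂ) (v : E) : Prop :=
  v ≠ 0 ∧ ∃ h : v ∈ A.domain, A ⟨v, h⟩ = μ • v

/-- `μ` is an eigenvalue of `A`. -/
def IsEigenvalue (A : E →ₗ.[ℂ] E) (μ : ℂ) : Prop := ∃ v, IsEigenvector A μ v

/-- `ker ((μ - A)^m)`: the kernel of the `(m+1)`-st power consists of those `x ∈ dom A` for which
`(μ - A) x` lies in the kernel of the `m`-th power. -/
def kerPow (A : E →ₗ.[ℂ] E) (μ : ℂ) : ℕ → Submodule ℂ E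
  | 0 => ⊥
  | m + 1 => ((kerPow A μ m).comap (μ • A.domain.subtype - A.toFun)).map A.domain.subtype

/-- The generalised eigenspace: the union of the increasing sequence `ker ((μ - A)^m)`. -/
def genEigenspace (A : E →ₗ.[ℂ] E) (μ : ℂ) : Submodule ℂ E := ⨆ m, kerPow A μ m

/-- `μ` is an algebraically simple eigenvalue: its generalised eigenspace is one-dimensional. -/
def IsAlgSimple (A : E →ₗ.[ℂ] E) (μ : ℂ) : Prop :=
  IsEigenvalue A μ ∧ Module.finrank ℂ (genEigenspace A μ) = 1

/-- An operator given on the domain of `A`, as a partially defined operator. -/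
def onDomain (A : E →ₗ.[ℂ] E) (B : A.domain →ₗ[ℂ] E) : E →ₗ.[ℂ] E := ⟨A.domain, B⟩

/-- The operator `A + B` with domain `dom A`. -/
def perturb (A : E →ₗ.[ℂ] E) (B : A.domain →ₗ[ℂ] E) : E →ₗ.[ℂ] E := ⟨A.domain, A.toFun + B⟩

open Classical in
/-- The value `B y` for `y ∈ dom A` (and `0` elsewhere). -/
def evalAt {A : E →ₗ.[ℂ] E} (B : A.domain →ₗ[ℂ] E) (y : E) : E :=
  if h : y ∈ A.domain then B ⟨y, h⟩ else 0

/-- The supremum of the operator norms `‖B R(μ, A)‖` over the real `μ` with `|μ - μ₀| = r`. -/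
def betaSup {A : E →ₗ.[ℂ] E} (B : A.domain →ₗ[ℂ] E) (μ₀ r : ℝ) : ENNReal :=
  ⨆ (μ : ℝ) (_ : |μ - μ₀| = r) (x : E) (_ : ‖x‖ ≤ 1), ‖evalAt B (resolvent A μ x)‖ₑ

end UnboundedOp

/-! ## Strongly continuous semigroups -/

/-- A `C₀`-semigroup of bounded operators on `E`; only the values at `t ≥ 0` matter. -/
structure C0Semigroup (E : Type*) [NormedAddCommGroup E] [NormedSpace ℂ E] where
  /-- the operators `T(t)` -/
  T : ℝ → E →L[ℂ] E
  map_zero : T 0 = ContinuousLinearMap.id ℂ E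
  map_add : ∀ s t : ℝ, 0 ≤ s → 0 ≤ t → T (s + t) = (T s).comp (T t)
  tendsto_zero : ∀ x : E, Tendsto (fun t => T t x) (𝓝[>] 0) (𝓝 x)

namespace C0Semigroup

variable {E : Type*} [NormedAddCommGroup E] [NormedSpace ℂ E]

/-- `y` is the limit of the difference quotients `(T(t) x - x) / t` as `t ↓ 0`. -/
def HasGen (S : C0Semigroup E) (x y : E) : Prop :=
  Tendsto (fun t : ℝ => ((t⁻¹ : ℝ) : ℂ) • (S.T t x - x)) (𝓝[>] 0) (𝓝 y)

theorem HasGen.add {S : C0Semigroup E} {x y x' y' : E} (h : S.HasGen x y) (h' : S.HasGen x' y') :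
    S.HasGen (x + x') (y + y') := by
  refine (Tendsto.add h h').congr fun t => ?_
  rw [_root_.map_add (S.T t)]
  module

theorem HasGen.smul {S : C0Semigroup E} {x y : E} (a : ℂ) (h : S.HasGen x y) :
    S.HasGen (a • x) (a • y) := by
  refine (Tendsto.const_smul h a).congr fun t => ?_
  rw [_root_.map_smul (S.T t)]
  module

/-- The generator: its domain consists of the `x` for which the difference quotients converge,
and its value at `x` is the limit. -/
def generator (S : C0Semigroup E) : E →ₗ.[ℂ] E where
  domain :=
    { carrier := {x | ∃ y, S.HasGen x y}
      add_mem' := fun ⟨_, h⟩ ⟨_, h'⟩ => ⟨_, h.add h'⟩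
      zero_mem' := ⟨0, by simp [HasGen]⟩
      smul_mem' := fun a _ ⟨_, h⟩ => ⟨_, h.smul a⟩ }
  toFun :=
    { toFun := fun x => x.2.choose
      map_add' := fun x x' => tendsto_nhds_unique (x + x').2.choose_spec
        (x.2.choose_spec.add x'.2.choose_spec)
      map_smul' := fun a x => tendsto_nhds_unique (a • x).2.choose_spec
        (x.2.choose_spec.smul a) }

theorem hasGen_generator (S : C0Semigroup E) (x : S.generator.domain) :
    S.HasGen x (S.generator x) := x.2.choose_spec

/-- All orbits `t ↦ T(t) x` are differentiable on `(0, ∞)`. -/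
def ImmediatelyDifferentiable (S : C0Semigroup E) : Prop :=
  ∀ (x : E) (t : ℝ), 0 < t → DifferentiableAt ℝ (fun s => S.T s x) t

/-- `B` is bounded from `dom A`, with the graph norm of the generator `A`, to `E`. -/
def GraphBounded (S : C0Semigroup E) (B : S.generator.domain →ₗ[ℂ] E) : Prop :=
  ∃ M : ℝ, ∀ x : S.generator.domain, ‖B x‖ ≤ M * (‖(x : E)‖ + ‖S.generator x‖)

/-- `∫₀^{t₀} ‖B T(s) x‖ ds ≤ q ‖x‖` on `dom A`, for some `q ∈ (0, 1)` and `t₀ > 0`. -/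
def Admissible (S : C0Semigroup E) (B : S.generator.domain →ₗ[ℂ] E) : Prop :=
  ∃ q t₀ : ℝ, 0 < q ∧ q < 1 ∧ 0 < t₀ ∧ ∀ x ∈ S.generator.domain,
    ∫ s in (0 : ℝ)..t₀, ‖UnboundedOp.evalAt B (S.T s x)‖ ≤ q * ‖x‖

end C0Semigroup

namespace LatticeCplx

variable {F : Type*} [NormedAddCommGroup F] [Lattice F] [HasSolidNorm F] [IsOrderedAddMonoid F]
  [NormedSpace ℝ F] [IsOrderedModule ℝ F] [CompleteSpace F]

/-- Ultracontractivity with respect to `E_u`: `T(t) E ⊆ E_u` with `‖T(t)‖_{E → E_u} ≤ C t^{-α}`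
for `t ∈ (0, 1]`. -/
def Ultracontractive (S : C0Semigroup (LatticeCplx F)) (u : F) : Prop :=
  ∃ C α : ℝ, 1 ≤ C ∧ 0 < α ∧ ∀ t ∈ Ioc (0 : ℝ) 1, ∀ x : LatticeCplx F,
    S.T t x ∈ principalIdeal u ∧ gaugeNorm u (S.T t x) ≤ C * t ^ (-α) * ‖x‖

/-- The estimates on `E_u`: `‖T(t)‖_{E_u → E_u} ≤ C` and `‖B T(t) x‖_{E_u} ≤ C t^{-β} ‖x‖_{E_u}`
for `t ∈ (0, 1]` and `x ∈ E_u` with `T(t) x` in the domain of `B`. -/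
def IdealBounds (S : C0Semigroup (LatticeCplx F))
    (B : S.generator.domain →ₗ[ℂ] LatticeCplx F) (u : F) : Prop :=
  ∃ C β : ℝ, 1 ≤ C ∧ 0 ≤ β ∧ β < 1 ∧ ∀ t ∈ Ioc (0 : ℝ) 1, ∀ x ∈ principalIdeal u,
    (S.T t x ∈ principalIdeal u ∧ gaugeNorm u (S.T t x) ≤ C * gaugeNorm u x) ∧
    ∀ h : S.T t x ∈ S.generator.domain,
      B ⟨S.T t x, h⟩ ∈ principalIdeal u ∧
        gaugeNorm u (B ⟨S.T t x, h⟩) ≤ C * t ^ (-β) * gaugeNorm u x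

end LatticeCplx

end

/-!
Put `μ₀ = l₀ + r` and `R = R(μ₀, A)`. The perturbations are parametrised by the bounded operators
`b = B R`, since `μ - A - B` equals `(1 - b + (μ - μ₀) R) (μ₀ - A)`. At the simple pole `l₀` this
operator pencil becomes invertible once it is bordered by the eigenvector and a functional not
vanishing on it, so the implicit function theorem gives a smooth branch `b ↦ (lam b, R (y b))` of
eigenpairs, which carries the only eigenvalues near `l₀`; on the rest of the compact interval
`[l₀ - r, l₀ + r]` the pencil stays invertible. As the operators are real and `lam b` is unique, it
is real.

The eigenvectors `v(κ)` converge in `E`, and the point is that they converge in `E_u`. Duhamel's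
formula reads `v(κ) = e^{-λt} T(t) v(κ) + ∫₀ᵗ e^{-λs} T(s) B(κ) v(κ) ds`. The first term converges
in `E_u` by ultracontractivity, so it suffices to bound `‖T(s) B(κ) v(κ)‖_{E_u}` near `κ = 0` by
`K s^{-1/2}`, and then to let `t → 0`. For fixed `κ`, applying `B(κ)` to the formula exhibits
`B(κ) v(κ)` as the fixed point of a contraction of `E` which leaves an order interval of `E_u`
invariant; this bounds the orbit, but without uniformity in `κ`, while ultracontractivity gives the
uniform but non-integrable rate `s^{-α}`. Since `κ ↦ T(s) B(κ) v(κ)` is holomorphic, Hartogs' lemma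
for the subharmonic functions `log ‖T(s) B(κ) v(κ)‖_{E_u} / log (1/s)` lowers the exponent to any
positive value, at the cost of shrinking the disc.
-/

/-! ### Hartogs' lemma -/

section Hartogs

open MeasureTheory Real

theorem log_norm_le_circleAverage {g : ℂ → ℂ} {c : ℂ} {r : ℝ} (hr : 0 < r)
    (hg : AnalyticOnNhd ℂ g (Metric.closedBall c r)) (hgc : g c ≠ 0) :
    log ‖g c‖ ≤ circleAverage (fun z => log ‖g z‖) c r := by
  rw [← abs_of_pos hr] at hg
  have zeros_nonneg : 0 ≤ ∑ᶠ w, (MeromorphicOn.divisor g (Metric.closedBall c |r|) w : ℝ) *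
      log (r * ‖c - w‖⁻¹) := by
    refine finsum_nonneg fun w => ?_
    by_cases hw : w ∈ Metric.closedBall c |r|
    · refine mul_nonneg
        (by exact_mod_cast MeromorphicOn.AnalyticOnNhd.divisor_nonneg hg w) ?_
      rcases eq_or_ne c w with rfl | hcw
      · simp
      · have hpos : 0 < ‖c - w‖ := norm_pos_iff.2 (sub_ne_zero.2 hcw)
        rw [abs_of_pos hr, Metric.mem_closedBall, dist_comm, dist_eq_norm] at hw
        exact log_nonneg (by rwa [← div_eq_mul_inv, one_le_div hpos])
    · simp [Function.locallyFinsuppWithin.apply_eq_zero_of_notMem _ hw]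
  have jensen := hg.circleAverage_log_norm hr.ne' hgc
  linarith

theorem posLog_norm_le_circleAverage {g : ℂ → ℂ} {c : ℂ} {r : ℝ} (hr : 0 < r)
    (hg : AnalyticOnNhd ℂ g (Metric.closedBall c r)) :
    log⁺ ‖g c‖ ≤ circleAverage (fun z => log⁺ ‖g z‖) c r := by
  rcases le_or_gt ‖g c‖ 1 with h1 | h1
  · rw [(posLog_eq_zero_iff _).2 (by simpa using h1)]
    exact circleAverage_nonneg_of_nonneg fun _ _ => posLog_nonneg
  have hsphere : Metric.sphere c |r| ⊆ Metric.closedBall c r := by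
    rw [abs_of_pos hr]; exact Metric.sphere_subset_closedBall
  rw [posLog_eq_log (by simpa using h1.le)]
  refine (log_norm_le_circleAverage hr hg (norm_pos_iff.1 (one_pos.trans h1))).trans
    (circleAverage_mono ?_ ?_ fun z _ => ?_)
  · exact MeromorphicOn.circleIntegrable_log_norm fun z hz => (hg z (hsphere hz)).meromorphicAt
  · exact ContinuousOn.circleIntegrable'
      (continuous_posLog.comp_continuousOn (hg.continuousOn.mono hsphere).norm)
  · exact le_max_right _ _

theorem setLIntegral_ball_eq_polar {f : ℂ → ENNReal} {c : ℂ} {R : ℝ}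
    (hf : Measurable ((Metric.ball c R).indicator f)) :
    ∫⁻ z in Metric.ball c R, f z =
      ∫⁻ r in Ioo 0 R, ENNReal.ofReal r * ∫⁻ θ in Ioo (-π) π, f (circleMap c r θ) := by
  set g := (Metric.ball c R).indicator f with hg
  have polar_eq_circleMap : ∀ p : ℝ × ℝ, c + Complex.polarCoord.symm p = circleMap c p.1 p.2 :=
    fun p => by
      rw [Complex.polarCoord_symm_apply, circleMap, Complex.exp_mul_I]; push_cast; ring
  have hmeas : Measurable fun p : ℝ × ℝ => ENNReal.ofReal p.1 * g (circleMap c p.1 p.2) := by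
    refine measurable_fst.ennreal_ofReal.mul (hf.comp (Continuous.measurable ?_))
    simp only [circleMap]; fun_prop
  rw [← lintegral_indicator measurableSet_ball, ← hg, ← lintegral_add_left_eq_self g c,
    ← Complex.lintegral_comp_polarCoord_symm]
  simp only [polar_eq_circleMap, smul_eq_mul]
  rw [polarCoord_target, Measure.volume_eq_prod, ← Measure.prod_restrict,
    lintegral_prod _ hmeas.aemeasurable, ← Ioi_inter_Iio (a := (0 : ℝ)),
    inter_comm, ← Measure.restrict_restrict measurableSet_Iio,
    ← lintegral_indicator measurableSet_Iio]
  refine setLIntegral_congr_fun measurableSet_Ioi fun r (hr : 0 < r) => ?_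
  have mem_ball_iff : ∀ θ, circleMap c r θ ∈ Metric.ball c R ↔ r ∈ Iio R := fun θ => by
    simp [circleMap, abs_of_pos hr]
  rw [lintegral_const_mul' _ _ ENNReal.ofReal_ne_top]
  by_cases hrR : r ∈ Iio R <;> simp [hg, indicator, mem_ball_iff, hrR]

theorem integral_Ioo_circleMap_eq_circleAverage (h : ℂ → ℝ) (c : ℂ) (r : ℝ) :
    ∫ θ in Ioo (-π) π, h (circleMap c r θ) = 2 * π * circleAverage h c r := by
  have hper : Function.Periodic (fun θ => h (circleMap c r θ)) (2 * π) :=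
    fun θ => by simp only [periodic_circleMap c r θ]
  have hshift := hper.intervalIntegral_add_eq 0 (-π)
  rw [zero_add, show -π + 2 * π = π by ring] at hshift
  rw [circleAverage_def, hshift, smul_eq_mul, mul_inv_cancel_left₀ (by positivity),
    ← integral_Ioc_eq_integral_Ioo, intervalIntegral.integral_of_le (by linarith [pi_pos])]

theorem ofReal_mul_volume_ball_le_lintegral {h : ℂ → ℝ} {c : ℂ} {R a : ℝ}
    (hcont : ContinuousOn h (Metric.ball c R)) (hnn : ∀ z, 0 ≤ h z)
    (hmean : ∀ r, 0 < r → r < R → a ≤ circleAverage h c r) :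
    ENNReal.ofReal a * volume (Metric.ball c R) ≤
      ∫⁻ z in Metric.ball c R, ENNReal.ofReal (h z) := by
  have hmeas : Measurable ((Metric.ball c R).indicator fun z => ENNReal.ofReal (h z)) := by
    classical
    rw [← piecewise_eq_indicator]
    exact (ENNReal.continuous_ofReal.comp_continuousOn hcont).measurable_piecewise
      continuousOn_const measurableSet_ball
  rw [setLIntegral_ball_eq_polar hmeas, ← setLIntegral_const, setLIntegral_ball_eq_polar
    (measurable_const.indicator measurableSet_ball)]
  refine setLIntegral_mono' measurableSet_Ioo fun r hr => ?_
  gcongr 1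
  have hcirc : Continuous fun θ => h (circleMap c r θ) := by
    refine hcont.comp_continuous (continuous_circleMap c r) fun θ => ?_
    simp [circleMap, abs_of_pos hr.1, hr.2]
  have hint : IntegrableOn (fun θ => h (circleMap c r θ)) (Ioo (-π) π) :=
    hcirc.integrableOn_Icc.mono_set Ioo_subset_Icc_self
  rw [← ofReal_integral_eq_lintegral_ofReal hint (ae_of_all _ fun θ => hnn _), setLIntegral_const,
    volume_Ioo, mul_comm, ← ENNReal.ofReal_mul (by linarith [pi_pos]),
    integral_Ioo_circleMap_eq_circleAverage]
  apply ENNReal.ofReal_le_ofReal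
  nlinarith [hmean r hr.1 hr.2, pi_pos]

theorem posLog_norm_mul_volume_ball_le_lintegral {U : Type*} [NormedAddCommGroup U]
    [NormedSpace ℂ U] {f : ℂ → U} {c : ℂ} {R : ℝ}
    (hf : DifferentiableOn ℂ f (Metric.ball c R)) :
    ENNReal.ofReal (log⁺ ‖f c‖) * volume (Metric.ball c R) ≤
      ∫⁻ z in Metric.ball c R, ENNReal.ofReal (log⁺ ‖f z‖) := by
  obtain ⟨ψ, hψ, hψc⟩ := exists_dual_vector'' ℂ (f c)
  have hd : DifferentiableOn ℂ (fun z => ψ (f z)) (Metric.ball c R) :=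
    ψ.differentiable.comp_differentiableOn hf
  have hnorm : ‖f c‖ = ‖ψ (f c)‖ := by simp [hψc]
  rw [hnorm]
  refine (ofReal_mul_volume_ball_le_lintegral (h := fun z => log⁺ ‖ψ (f z)‖)
    (continuous_posLog.comp_continuousOn hd.continuousOn.norm) (fun _ => posLog_nonneg)
    fun r hr hrR => posLog_norm_le_circleAverage hr ?_).trans
    (lintegral_mono fun z => ENNReal.ofReal_le_ofReal (posLog_le_posLog (norm_nonneg _) ?_))
  · exact (hd.analyticOnNhd Metric.isOpen_ball).mono (Metric.closedBall_subset_ball hrR)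
  · simpa using ψ.le_of_opNorm_le hψ (f z)

theorem norm_le_mul_rpow_of_norm_le_off {U : Type*} [NormedAddCommGroup U] [NormedSpace ℂ U]
    {f : ℂ → U} {c : ℂ} {R m D η : ℝ} {X : Set ℂ} (hR : 0 < R) (hm : 1 ≤ m) (hD : 1 ≤ D)
    (hη : 0 ≤ η) (hf : DifferentiableOn ℂ f (Metric.ball c R)) (hX : MeasurableSet X)
    (hvol : volume X ≤ ENNReal.ofReal η * volume (Metric.ball c R))
    (hfD : ∀ z ∈ Metric.ball c R, ‖f z‖ ≤ D) (hfm : ∀ z ∈ Metric.ball c R \ X, ‖f z‖ ≤ m) :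
    ‖f c‖ ≤ m * D ^ η := by
  set V := volume (Metric.ball c R)
  have posLog_le : ∀ {x y : ℝ}, 0 ≤ x → 1 ≤ y → x ≤ y → log⁺ x ≤ log y := fun h0 h1 hxy => by
    rw [← posLog_eq_log (h1.trans (le_abs_self _))]
    exact posLog_le_posLog h0 hxy
  have integral_le : ∫⁻ z in Metric.ball c R, ENNReal.ofReal (log⁺ ‖f z‖) ≤
      ENNReal.ofReal (log m + η * log D) * V := by
    calc ∫⁻ z in Metric.ball c R, ENNReal.ofReal (log⁺ ‖f z‖)
      _ ≤ ∫⁻ z in Metric.ball c R, (ENNReal.ofReal (log m) +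
            X.indicator (fun _ => ENNReal.ofReal (log D)) z) := by
          refine setLIntegral_mono' measurableSet_ball fun z hz => ?_
          by_cases hzX : z ∈ X
          · rw [indicator_of_mem hzX]
            exact le_add_left (ENNReal.ofReal_le_ofReal
              (posLog_le (norm_nonneg _) hD (hfD z hz)))
          · exact le_add_right (ENNReal.ofReal_le_ofReal
              (posLog_le (norm_nonneg _) hm (hfm z ⟨hz, hzX⟩)))
      _ ≤ ENNReal.ofReal (log m) * V + ENNReal.ofReal (log D) * volume X := by
          rw [lintegral_add_left measurable_const, setLIntegral_const]
          gcongr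
          refine (setLIntegral_le_lintegral _ _).trans ?_
          rw [lintegral_indicator_const hX]
      _ ≤ ENNReal.ofReal (log m) * V + ENNReal.ofReal (log D) * (ENNReal.ofReal η * V) := by
          gcongr
      _ = ENNReal.ofReal (log m + η * log D) * V := by
          rw [ENNReal.ofReal_add (log_nonneg hm) (mul_nonneg hη (log_nonneg hD)),
            ENNReal.ofReal_mul hη]
          ring
  have log_le := (ENNReal.mul_le_mul_iff_left (Metric.measure_ball_pos _ _ hR).ne'
    measure_ball_lt_top.ne).1 ((posLog_norm_mul_volume_ball_le_lintegral hf).trans integral_le)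
  rw [ENNReal.ofReal_le_ofReal_iff (add_nonneg (log_nonneg hm) (mul_nonneg hη (log_nonneg hD))),
    posLog_eq_log_max_one (norm_nonneg _), ← log_rpow (by positivity),
    ← log_mul (by positivity) (by positivity),
    log_le_log_iff (by positivity) (by positivity)] at log_le
  exact (le_max_right _ _).trans log_le

theorem isOpen_sep_exists_lt {α ι : Type*} [TopologicalSpace α] {g : ι → α → ℝ} {U : Set α}
    (hU : IsOpen U) (hg : ∀ i, ContinuousOn (g i) U) (a : ℝ) :
    IsOpen {x ∈ U | ∃ i, a < g i x} := by
  have : {x ∈ U | ∃ i, a < g i x} = ⋃ i, U ∩ g i ⁻¹' Ioi a := by ext; simp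
  rw [this]
  exact isOpen_iUnion fun i => (hg i).isOpen_inter_preimage hU isOpen_Ioi

theorem tendsto_measure_exists_lt {α ι : Type*} [TopologicalSpace α] [MeasurableSpace α]
    [OpensMeasurableSpace α] {μ : Measure α} {g : ι → α → ℝ} {U : Set α} (hU : IsOpen U)
    (hμ : μ U ≠ ⊤) (hg : ∀ i, ContinuousOn (g i) U)
    (hb : ∀ x ∈ U, BddAbove (range fun i => g i x)) :
    Tendsto (fun m : ℕ => μ {x ∈ U | ∃ i, m < g i x}) atTop (𝓝 0) := by
  have hanti : Antitone fun m : ℕ => {x ∈ U | ∃ i, m < g i x} :=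
    fun m n hmn x ⟨hx, i, hi⟩ => ⟨hx, i, (Nat.cast_le.2 hmn).trans_lt hi⟩
  have hempty : ⋂ m : ℕ, {x ∈ U | ∃ i, m < g i x} = ∅ := by
    refine eq_empty_iff_forall_notMem.2 fun x hx => ?_
    rw [mem_iInter] at hx
    obtain ⟨M, hM⟩ := hb x (hx 0).1
    obtain ⟨n, hn⟩ := exists_nat_ge M
    obtain ⟨-, i, hi⟩ := hx n
    exact (hn.trans_lt hi).not_ge (hM ⟨i, rfl⟩)
  simpa [hempty, Function.comp_def] using tendsto_measure_iInter_atTop (μ := μ)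
    (fun m : ℕ => (isOpen_sep_exists_lt hU hg m).measurableSet.nullMeasurableSet) hanti
    ⟨0, measure_ne_top_of_subset (sep_subset _ _) hμ⟩

theorem exists_norm_le_mul_rpow_of_pointwise_bounded {ι U : Type*} [NormedAddCommGroup U]
    [NormedSpace ℂ U] {g : ι → ℂ → U} {D : ι → ℝ} {c : ℂ} {R η : ℝ} (hR : 0 < R) (hη : 0 < η)
    (hg : ∀ i, DifferentiableOn ℂ (g i) (Metric.ball c (2 * R))) (hD : ∀ i, 1 ≤ D i)
    (hgD : ∀ i, ∀ z ∈ Metric.ball c (2 * R), ‖g i z‖ ≤ D i)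
    (hpt : ∀ z ∈ Metric.ball c (2 * R), BddAbove (range fun i => ‖g i z‖)) :
    ∃ m, ∀ i, ∀ z ∈ Metric.ball c R, ‖g i z‖ ≤ m * D i ^ η := by
  let X : ℕ → Set ℂ := fun m => {z ∈ Metric.ball c (2 * R) | ∃ i, m < ‖g i z‖}
  have hX : ∀ m, MeasurableSet (X m) := fun m =>
    (isOpen_sep_exists_lt Metric.isOpen_ball (fun i => (hg i).continuousOn.norm) m).measurableSet
  have volume_pos : 0 < ENNReal.ofReal η * volume (Metric.ball c R) :=
    ENNReal.mul_pos (by simpa using hη) (Metric.measure_ball_pos _ _ hR).ne'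
  obtain ⟨m, hvol, hm⟩ := (((tendsto_measure_exists_lt (μ := volume) Metric.isOpen_ball
    measure_ball_lt_top.ne (fun i => (hg i).continuousOn.norm) hpt).eventually_lt_const
    volume_pos).and (eventually_ge_atTop 1)).exists
  refine ⟨m, fun i z hz => ?_⟩
  have hsub : Metric.ball z R ⊆ Metric.ball c (2 * R) :=
    Metric.ball_subset_ball' (by linarith [Metric.mem_ball.1 hz])
  refine norm_le_mul_rpow_of_norm_le_off hR (by exact_mod_cast hm) (hD i) hη.le
    ((hg i).mono hsub) (hX m) ?_ (fun w hw => hgD i w (hsub hw)) fun w hw => ?_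
  · rw [Measure.addHaar_ball_center, ← Measure.addHaar_ball_center volume c]
    exact hvol.le
  · exact not_lt.1 fun h => hw.2 ⟨hsub hw.1, i, h⟩

end Hartogs

section OperatorValued

theorem norm_sub_sub_smul_deriv_le {G : Type*} [NormedAddCommGroup G] [NormedSpace ℂ G]
    {f : ℂ → G} {c w : ℂ} {ρ M : ℝ} (hf : DifferentiableOn ℂ f (Metric.ball c ρ))
    (hM : ∀ z ∈ Metric.ball c ρ, ‖f z‖ ≤ M) (hw : w ∈ Metric.ball c ρ) :
    ‖f w - f c - (w - c) • deriv f c‖ ≤ 4 * M * (‖w - c‖ / ρ) ^ 2 := by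
  have hρ : 0 < ρ := Metric.nonempty_ball.1 ⟨w, hw⟩
  have hc : c ∈ Metric.ball c ρ := Metric.mem_ball_self hρ
  have hdist : ∀ z ∈ Metric.ball c ρ, ‖f z - f c‖ ≤ 2 * M := fun z hz =>
    (norm_sub_le _ _).trans (by linarith [hM z hz, hM c hc])
  have hderiv : ‖deriv f c‖ ≤ 2 * M / ρ := Complex.norm_deriv_le_div_of_mapsTo_ball hf
    (fun z hz => mem_closedBall_iff_norm.2 (hdist z hz)) hρ
  let g : ℂ → G := fun z => f z - f c - (z - c) • deriv f c
  have hgc : g c = 0 := by simp [g]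
  have maps : MapsTo g (Metric.ball c ρ) (Metric.closedBall (g c) (4 * M)) := fun z hz => by
    have hz' : ‖z - c‖ ≤ ρ := (mem_ball_iff_norm.1 hz).le
    rw [hgc, mem_closedBall_zero_iff]
    calc ‖g z‖ ≤ ‖f z - f c‖ + ‖z - c‖ * ‖deriv f c‖ :=
          (norm_sub_le _ _).trans_eq (by rw [norm_smul])
      _ ≤ 2 * M + ρ * (2 * M / ρ) := by gcongr; exact hdist z hz
      _ = 4 * M := by field_simp; ring
  have littleO : (fun z => g z - g c) =o[𝓝 c] fun z => ‖z - c‖ ^ 1 := by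
    simpa [g, Asymptotics.isLittleO_norm_right] using
      (hf.differentiableAt (Metric.ball_mem_nhds c hρ)).hasDerivAt.isLittleO
  simpa [hgc, dist_eq_norm] using Complex.dist_le_mul_div_pow_of_mapsTo_ball_of_isLittleO
    ((hf.sub_const _).sub (by fun_prop)) maps littleO hw

variable {E G : Type*} [NormedAddCommGroup E] [NormedSpace ℂ E] [CompleteSpace E]
  [NormedAddCommGroup G] [NormedSpace ℂ G] {b : ℂ → E →L[ℂ] G} {s : Set ℂ}

theorem exists_opNorm_le_of_continuousOn_apply {K : Set ℂ} (hK : IsCompact K)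
    (hb : ∀ x, ContinuousOn (fun κ => b κ x) K) : ∃ M, ∀ κ ∈ K, ‖b κ‖ ≤ M := by
  obtain ⟨M, hM⟩ := banach_steinhaus (g := fun κ : K => b κ) fun x =>
    (hK.exists_bound_of_continuousOn (hb x)).imp fun _ h κ => h κ κ.2
  exact ⟨M, fun κ hκ => hM ⟨κ, hκ⟩⟩

theorem differentiableOn_clm_of_apply (hs : IsOpen s)
    (hb : ∀ x, DifferentiableOn ℂ (fun κ => b κ x) s) : DifferentiableOn ℂ b s := by
  intro c hc
  obtain ⟨ρ, hρ, hball⟩ := Metric.nhds_basis_closedBall.mem_iff.1 (hs.mem_nhds hc)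
  obtain ⟨M, hM⟩ := exists_opNorm_le_of_continuousOn_apply (isCompact_closedBall c ρ)
    fun x => (hb x).continuousOn.mono hball
  have hsub : Metric.ball c ρ ⊆ s := Metric.ball_subset_closedBall.trans hball
  have happly : ∀ x, ∀ z ∈ Metric.ball c ρ, ‖b z x‖ ≤ M * ‖x‖ := fun x z hz =>
    (b z).le_of_opNorm_le (hM z (Metric.ball_subset_closedBall hz)) x
  have hdiff : ∀ x, DifferentiableAt ℂ (fun κ => b κ x) c := fun x =>
    (hb x).differentiableAt (hs.mem_nhds hc)
  let b' : E →L[ℂ] G := LinearMap.mkContinuous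
    { toFun := fun x => deriv (fun κ => b κ x) c
      map_add' := fun x y => by simpa using deriv_fun_add (hdiff x) (hdiff y)
      map_smul' := fun a x => by simpa using deriv_fun_const_smul a (hdiff x) } (2 * M / ρ)
    fun x => by
      refine (Complex.norm_deriv_le_div_of_mapsTo_ball (R₂ := 2 * M * ‖x‖) ((hb x).mono hsub)
        (fun z hz => ?_) hρ).trans_eq (by ring)
      rw [mem_closedBall_iff_norm]
      refine (norm_sub_le _ _).trans ?_
      linarith [happly x z hz, happly x c (Metric.mem_ball_self hρ)]
  have quadratic : ∀ w ∈ Metric.ball c ρ,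
      ‖b w - b c - (w - c) • b'‖ ≤ 4 * M * (‖w - c‖ / ρ) ^ 2 := fun w hw => by
    have hM0 : 0 ≤ M := (norm_nonneg _).trans (hM c (Metric.mem_closedBall_self hρ.le))
    refine ContinuousLinearMap.opNorm_le_bound _ (by positivity) fun x => ?_
    exact (norm_sub_sub_smul_deriv_le ((hb x).mono hsub) (happly x) hw).trans_eq (by ring)
  have hO : (fun w => b w - b c - (w - c) • b') =O[𝓝 c] fun w => ‖w - c‖ ^ 2 := by
    refine Asymptotics.IsBigO.of_bound (4 * M / ρ ^ 2) ?_
    filter_upwards [Metric.ball_mem_nhds c hρ] with w hw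
    refine (quadratic w hw).trans_eq ?_
    rw [Real.norm_of_nonneg (by positivity)]
    ring
  exact (hasDerivAt_iff_isLittleO.2 (hO.trans_isLittleO
    (Asymptotics.isLittleO_pow_sub_sub c one_lt_two))).differentiableAt.differentiableWithinAt

end OperatorValued

/-! ### Relatively bounded perturbations -/

namespace UnboundedOp

variable {E : Type*} [NormedAddCommGroup E] [NormedSpace ℂ E] {A : E →ₗ.[ℂ] E}

theorem isResolventAt_resolvent {μ : ℂ} (h : μ ∈ resolventSet A) :
    IsResolventAt A μ (resolvent A μ) := by
  rw [resolvent, dif_pos h]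
  exact h.choose_spec

theorem mem_kerPow_succ {μ : ℂ} {m : ℕ} {x : E} :
    x ∈ kerPow A μ (m + 1) ↔ ∃ h : x ∈ A.domain, μ • x - A ⟨x, h⟩ ∈ kerPow A μ m := by
  simp only [kerPow, Submodule.mem_map, Submodule.mem_comap]
  exact ⟨by rintro ⟨y, hy, rfl⟩; exact ⟨y.2, hy⟩, fun ⟨h, hx⟩ => ⟨⟨x, h⟩, hx, rfl⟩⟩

theorem kerPow_le_genEigenspace (A : E →ₗ.[ℂ] E) (μ : ℂ) (m : ℕ) :
    kerPow A μ m ≤ genEigenspace A μ := le_iSup (kerPow A μ) m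

theorem IsEigenvector.mem_kerPow_one {μ : ℂ} {v : E} (hv : IsEigenvector A μ v) :
    v ∈ kerPow A μ 1 := by
  obtain ⟨-, hd, hA⟩ := hv
  exact mem_kerPow_succ.2 ⟨hd, by simp [hA]⟩

theorem IsAlgSimple.exists_smul_eq {μ : ℂ} (h : IsAlgSimple A μ) {v : E}
    (hv : IsEigenvector A μ v) {m : ℕ} {x : E} (hx : x ∈ kerPow A μ m) : ∃ a : ℂ, a • v = x := by
  have hv' : v ∈ genEigenspace A μ := kerPow_le_genEigenspace A μ 1 hv.mem_kerPow_one
  obtain ⟨a, ha⟩ := (finrank_eq_one_iff_of_nonzero' (⟨v, hv'⟩ : genEigenspace A μ)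
    (by simpa using hv.1)).1 h.2 ⟨x, kerPow_le_genEigenspace A μ m hx⟩
  exact ⟨a, congrArg Subtype.val ha⟩

theorem isAlgSimple_of_kerPow_le_span {μ : ℂ} {v : E} (hv : IsEigenvector A μ v)
    (h : ∀ m, kerPow A μ m ≤ Submodule.span ℂ {v}) : IsAlgSimple A μ := by
  have hspan : genEigenspace A μ = Submodule.span ℂ {v} := by
    refine le_antisymm (iSup_le h) ((Submodule.span_singleton_le_iff_mem _ _).2 ?_)
    exact kerPow_le_genEigenspace A μ 1 hv.mem_kerPow_one
  exact ⟨⟨v, hv⟩, hspan ▸ finrank_span_singleton hv.1⟩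

namespace IsResolventAt

variable {μ₀ : ℂ} {R : E →L[ℂ] E}

theorem mem_domain (h : IsResolventAt A μ₀ R) (y : E) : R y ∈ A.domain := (h.1 y).1

theorem apply_eq (h : IsResolventAt A μ₀ R) (y : E) :
    A ⟨R y, h.mem_domain y⟩ = μ₀ • R y - y := by
  rw [eq_sub_iff_add_eq, ← eq_sub_iff_add_eq', (h.1 y).2]

theorem injective (h : IsResolventAt A μ₀ R) : Function.Injective R := by
  intro y z hyz
  rw [← (h.1 y).2, ← (h.1 z).2]
  simp only [hyz]

theorem exists_apply_of_mem_domain (h : IsResolventAt A μ₀ R) {x : E} (hx : x ∈ A.domain) :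
    ∃ y, R y = x := ⟨_, h.2 ⟨x, hx⟩⟩

end IsResolventAt

/-- The relatively bounded perturbation `b (μ₀ - A)` of `A` given by a bounded operator `b`; for
`μ₀ ∈ ρ(A)` every graph-bounded operator has this form with `b = B R(μ₀, A)`, so that such
perturbations are parametrised by the Banach algebra of bounded operators. -/
def relPerturbation (A : E →ₗ.[ℂ] E) (μ₀ : ℂ) (b : E →L[ℂ] E) : A.domain →ₗ[ℂ] E :=
  (b : E →ₗ[ℂ] E) ∘ₗ (μ₀ • A.domain.subtype - A.toFun)

theorem relPerturbation_apply (μ₀ : ℂ) (b : E →L[ℂ] E) (x : A.domain) :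
    relPerturbation A μ₀ b x = b (μ₀ • (x : E) - A x) := rfl

theorem perturb_relPerturbation_zero (A : E →ₗ.[ℂ] E) (μ₀ : ℂ) :
    perturb A (relPerturbation A μ₀ 0) = A :=
  LinearPMap.ext rfl fun x h _ => by
    change A ⟨x, _⟩ + relPerturbation A μ₀ 0 ⟨x, _⟩ = _
    simp [relPerturbation_apply]

theorem relPerturbation_resolvent_apply {μ₀ : ℂ} {R : E →L[ℂ] E} (hR : IsResolventAt A μ₀ R)
    (b : E →L[ℂ] E) (y : E) : relPerturbation A μ₀ b ⟨R y, hR.mem_domain y⟩ = b y := by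
  rw [relPerturbation_apply, hR.apply_eq, sub_sub_cancel]

theorem exists_eq_relPerturbation {μ₀ : ℂ} {R : E →L[ℂ] E} (hR : IsResolventAt A μ₀ R)
    {B : A.domain →ₗ[ℂ] E} {M : ℝ} (hB : ∀ x : A.domain, ‖B x‖ ≤ M * (‖(x : E)‖ + ‖A x‖)) :
    ∃ b : E →L[ℂ] E, B = relPerturbation A μ₀ b := by
  let b₀ : E →ₗ[ℂ] E := B ∘ₗ R.toLinearMap.codRestrict A.domain hR.mem_domain
  have hb₀ : ∀ y, b₀ y = B ⟨R y, hR.mem_domain y⟩ := fun y => rfl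
  refine ⟨b₀.mkContinuous (|M| * (‖R‖ + (‖μ₀‖ * ‖R‖ + 1))) fun y => ?_, LinearMap.ext fun x => ?_⟩
  · calc ‖b₀ y‖ ≤ M * (‖R y‖ + ‖μ₀ • R y - y‖) := by
          rw [hb₀, ← hR.apply_eq]; exact hB _
      _ ≤ |M| * (‖R‖ * ‖y‖ + (‖μ₀‖ * (‖R‖ * ‖y‖) + ‖y‖)) := by
          gcongr
          · exact le_abs_self M
          · exact R.le_opNorm y
          · refine (norm_sub_le _ _).trans ?_
            rw [norm_smul]
            gcongr
            exact R.le_opNorm y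
      _ = |M| * (‖R‖ + (‖μ₀‖ * ‖R‖ + 1)) * ‖y‖ := by ring
  · obtain ⟨y, hy⟩ := hR.exists_apply_of_mem_domain x.2
    obtain rfl : ⟨R y, hR.mem_domain y⟩ = x := Subtype.ext hy
    rw [relPerturbation_resolvent_apply hR]
    rfl

/-- The bounded operator `(μ - A - b (μ₀ - A)) R(μ₀, A)`, which carries the spectral information on
the perturbed operator at `μ`. -/
def pencil (R : E →L[ℂ] E) (μ₀ : ℂ) (b : E →L[ℂ] E) (μ : ℂ) : E →L[ℂ] E := 1 - b + (μ - μ₀) • R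

theorem pencil_apply (R : E →L[ℂ] E) (μ₀ : ℂ) (b : E →L[ℂ] E) (μ : ℂ) (y : E) :
    pencil R μ₀ b μ y = y - b y + (μ - μ₀) • R y := rfl

theorem pencil_zero_smul_eigenvector {R : E →L[ℂ] E} {μ₀ l : ℂ} {v : E}
    (hv : R ((μ₀ - l) • v) = v) : pencil R μ₀ 0 l ((μ₀ - l) • v) = 0 := by
  rw [pencil_apply, hv, zero_apply]
  module

section Pencil

variable {μ₀ μ l : ℂ} {R b : E →L[ℂ] E} (hR : IsResolventAt A μ₀ R)
include hR

theorem smul_sub_perturb_apply (y : E) :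
    μ • R y - perturb A (relPerturbation A μ₀ b) ⟨R y, hR.mem_domain y⟩ = pencil R μ₀ b μ y := by
  change μ • R y - (A ⟨R y, _⟩ + relPerturbation A μ₀ b ⟨R y, _⟩) = _
  rw [relPerturbation_resolvent_apply hR, hR.apply_eq, pencil_apply]
  module

theorem resolvent_mem_kerPow_succ {m : ℕ} {y : E} :
    R y ∈ kerPow (perturb A (relPerturbation A μ₀ b)) μ (m + 1) ↔
      pencil R μ₀ b μ y ∈ kerPow (perturb A (relPerturbation A μ₀ b)) μ m := by
  rw [mem_kerPow_succ, ← smul_sub_perturb_apply hR]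
  exact ⟨fun ⟨_, h⟩ => h, fun h => ⟨hR.mem_domain y, h⟩⟩

theorem resolvent_mem_kerPow_succ_unperturbed {m : ℕ} {y : E} :
    R y ∈ kerPow A μ (m + 1) ↔ pencil R μ₀ 0 μ y ∈ kerPow A μ m := by
  simpa only [perturb_relPerturbation_zero] using resolvent_mem_kerPow_succ hR (b := 0)

theorem isEigenvector_resolvent_iff {y : E} :
    IsEigenvector (perturb A (relPerturbation A μ₀ b)) μ (R y) ↔
      y ≠ 0 ∧ pencil R μ₀ b μ y = 0 := by
  rw [IsEigenvector, map_ne_zero_iff R hR.injective, ← smul_sub_perturb_apply hR, sub_eq_zero,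
    eq_comm (a := μ • R y)]
  exact and_congr_right fun _ => ⟨fun ⟨_, h⟩ => h, fun h => ⟨hR.mem_domain y, h⟩⟩

theorem isEigenvalue_perturb_iff :
    IsEigenvalue (perturb A (relPerturbation A μ₀ b)) μ ↔ ∃ y ≠ 0, pencil R μ₀ b μ y = 0 := by
  constructor
  · rintro ⟨v, hv⟩
    obtain ⟨y, rfl⟩ := hR.exists_apply_of_mem_domain hv.2.1
    exact ⟨y, (isEigenvector_resolvent_iff hR).1 hv⟩
  · exact fun ⟨y, hy⟩ => ⟨R y, (isEigenvector_resolvent_iff hR).2 hy⟩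

theorem resolvent_smul_eigenvector {v : E} (hv : IsEigenvector A l v) :
    R ((μ₀ - l) • v) = v := by
  obtain ⟨-, hd, hA⟩ := hv
  have h := hR.2 ⟨v, hd⟩
  rwa [hA, ← sub_smul] at h

theorem pencil_mul_one_add {R' : E →L[ℂ] E} (hR' : IsResolventAt A μ R') :
    pencil R μ₀ 0 μ * (1 + (μ₀ - μ) • R') = 1 := by
  ext y
  have h := hR.2 ⟨R' y, hR'.mem_domain y⟩
  rw [hR'.apply_eq, show μ₀ • R' y - (μ • R' y - y) = y + (μ₀ - μ) • R' y by module] at h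
  change pencil R μ₀ 0 μ (y + (μ₀ - μ) • R' y) = y
  rw [pencil_apply, h, zero_apply]
  module

theorem one_add_mul_pencil {R' : E →L[ℂ] E} (hR' : IsResolventAt A μ R') :
    (1 + (μ₀ - μ) • R') * pencil R μ₀ 0 μ = 1 := by
  ext y
  have h := hR'.2 ⟨R y, hR.mem_domain y⟩
  rw [hR.apply_eq, show μ • R y - (μ₀ • R y - y) = pencil R μ₀ 0 μ y by
    rw [pencil_apply, zero_apply]; module] at h
  change pencil R μ₀ 0 μ y + (μ₀ - μ) • R' (pencil R μ₀ 0 μ y) = y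
  rw [h, pencil_apply, zero_apply]
  module

theorem isUnit_pencil_zero (hμ : μ ∈ resolventSet A) : IsUnit (pencil R μ₀ 0 μ) := by
  obtain ⟨R', hR'⟩ := hμ
  exact ⟨⟨_, _, pencil_mul_one_add hR hR', one_add_mul_pencil hR hR'⟩, rfl⟩

theorem IsPoleOfResolvent.exists_analyticAt_pencil_mul (hpole : IsPoleOfResolvent A l)
    (hμ₀ : μ₀ ≠ l) : ∃ (G : ℂ → E →L[ℂ] E) (k : ℕ), AnalyticAt ℂ G l ∧ G l ≠ 0 ∧
      ∀ᶠ z in 𝓝 l, pencil R μ₀ 0 z * G z = (z - l) ^ (k + 1) • (1 : E →L[ℂ] E) := by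
  obtain ⟨-, hres, hmer, hord⟩ := hpole
  obtain ⟨n, hn⟩ := WithTop.ne_top_iff_exists.1 hord.ne_top
  rw [← hn] at hord
  obtain ⟨k, rfl⟩ : ∃ k : ℕ, n = -(k + 1 : ℤ) :=
    ⟨(-n - 1).toNat, by have : n < 0 := by exact_mod_cast hord
                        omega⟩
  obtain ⟨g, hg, hgl, hgR⟩ := (meromorphicOrderAt_eq_int_iff hmer).1 hn.symm
  let G : ℂ → E →L[ℂ] E := fun z => (z - l) ^ (k + 1) • 1 + (μ₀ - z) • g z
  have hG : AnalyticAt ℂ G l := by fun_prop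
  refine ⟨G, k, hG, by simpa [G, sub_eq_zero, hgl] using hμ₀, ?_⟩
  have hcont : ContinuousAt (fun z => pencil R μ₀ 0 z * G z) l := by
    have := hG.continuousAt
    unfold pencil; fun_prop
  refine (ContinuousAt.eventuallyEq_nhds_iff_eventuallyEq_nhdsNE hcont (by fun_prop)).1 ?_
  filter_upwards [hgR, hres, self_mem_nhdsWithin] with z hz hzρ hzl
  have hgz : g z = (z - l) ^ (k + 1) • resolvent A z := by
    rw [hz, smul_smul, ← zpow_natCast, ← zpow_add₀ (sub_ne_zero.2 hzl)]
    simp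
  have hGz : G z = (z - l) ^ (k + 1) • (1 + (μ₀ - z) • resolvent A z) := by
    simp only [G, hgz]
    module
  rw [hGz, mul_smul_comm, pencil_mul_one_add hR (isResolventAt_resolvent hzρ)]

end Pencil

end UnboundedOp

/-! ### The bordered pencil -/

namespace UnboundedOp

variable {E : Type*} [NormedAddCommGroup E] [NormedSpace ℂ E] {A : E →ₗ.[ℂ] E}
  {R b : E →L[ℂ] E} {μ₀ μ l : ℂ} {v y : E} {φ : E →L[ℂ] ℂ}

section Range

theorem hasDerivAt_pencil (R : E →L[ℂ] E) (μ₀ : ℂ) (b : E →L[ℂ] E) (μ : ℂ) :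
    HasDerivAt (pencil R μ₀ b) R μ := by
  change HasDerivAt (fun z => 1 - b + (z - μ₀) • R) R μ
  simpa using (((hasDerivAt_id' μ).sub_const μ₀).smul_const R).const_add (1 - b)

theorem pencil_mul_deriv {G : ℂ → E →L[ℂ] E} {k : ℕ} (hG : DifferentiableAt ℂ G l)
    (h : ∀ᶠ z in 𝓝 l, pencil R μ₀ 0 z * G z = (z - l) ^ (k + 1) • (1 : E →L[ℂ] E)) :
    R * G l + pencil R μ₀ 0 l * deriv G l = (if k = 0 then 1 else 0) := by
  have hpow : HasDerivAt (fun z : ℂ => (z - l) ^ (k + 1) • (1 : E →L[ℂ] E))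
      (if k = 0 then 1 else 0) l := by
    have := (((hasDerivAt_id' l).sub_const l).fun_pow (k + 1)).smul_const (1 : E →L[ℂ] E)
    rcases eq_or_ne k 0 with rfl | hk <;> simpa [*] using this
  exact ((hasDerivAt_pencil R μ₀ 0 l).mul hG.hasDerivAt).unique (hpow.congr_of_eventuallyEq h)

theorem exists_pencil_add_smul_eq (hR : IsResolventAt A μ₀ R) (hμ₀ : μ₀ ≠ l)
    (hpole : IsPoleOfResolvent A l) (hsimple : IsAlgSimple A l) (hv : IsEigenvector A l v) (x : E) :
    ∃ y, ∃ a : ℂ, pencil R μ₀ 0 l y + a • v = x := by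
  obtain ⟨G, k, hG, hGl, hGpow⟩ := hpole.exists_analyticAt_pencil_mul hR hμ₀
  have hG0 (y : E) : pencil R μ₀ 0 l (G l y) = 0 := by
    simpa using congr($(hGpow.self_of_nhds) y)
  have hGker (y : E) : R (G l y) ∈ kerPow A l 1 := 
    (resolvent_mem_kerPow_succ_unperturbed hR).2 (by simp [hG0])
  have hderiv := pencil_mul_deriv hG.differentiableAt hGpow
  rcases eq_or_ne k 0 with rfl | hk
  · obtain ⟨a, ha⟩ := hsimple.exists_smul_eq hv (hGker x)
    refine ⟨deriv G l x, a, ?_⟩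
    rw [ha, add_comm]
    exact congr($hderiv x)
  · rw [if_neg hk] at hderiv
    refine absurd (ContinuousLinearMap.ext fun y => hR.injective ?_) hGl
    have hsum : R (G l y) + pencil R μ₀ 0 l (deriv G l y) = 0 := congr($hderiv y)
    have hker : R (deriv G l y) ∈ kerPow A l 2 := by
      rw [resolvent_mem_kerPow_succ_unperturbed hR, ← neg_eq_of_add_eq_zero_right hsum]
      exact neg_mem (hGker y)
    obtain ⟨a, ha⟩ := hsimple.exists_smul_eq hv hker
    have hGy : deriv G l y = a • (μ₀ - l) • v := hR.injective <| by
      rw [map_smul, resolvent_smul_eigenvector hR hv, ha]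
    rw [hGy, map_smul, pencil_zero_smul_eigenvector (resolvent_smul_eigenvector hR hv)] at hsum
    simpa using hsum

end Range

/-- The pencil bordered by the vector `v` and the functional `φ ∘ R`: the operator
`(y, τ) ↦ (pencil y + τ v, φ (R y))`. At a simple eigenvalue the pencil is singular but its
bordering is invertible. -/
noncomputable def bordered (R : E →L[ℂ] E) (μ₀ : ℂ) (φ : E →L[ℂ] ℂ) (b : E →L[ℂ] E) (μ : ℂ)
    (v : E) : E × ℂ →L[ℂ] E × ℂ :=
  .inl ℂ E ℂ ∘L (pencil R μ₀ b μ ∘L .fst ℂ E ℂ + (ContinuousLinearMap.snd ℂ E ℂ).smulRight v) +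
    .inr ℂ E ℂ ∘L φ ∘L R ∘L .fst ℂ E ℂ

theorem bordered_apply (p : E × ℂ) :
    bordered R μ₀ φ b μ v p = (pencil R μ₀ b μ p.1 + p.2 • v, φ (R p.1)) := by
  simp [bordered]

theorem contDiff_bordered (R : E →L[ℂ] E) (μ₀ : ℂ) (φ : E →L[ℂ] ℂ) (v : E) :
    ContDiff ℂ 1 fun p : (E →L[ℂ] E) × ℂ => bordered R μ₀ φ p.1 p.2 v := by
  unfold bordered pencil
  fun_prop

theorem continuous_bordered (R : E →L[ℂ] E) (μ₀ : ℂ) (φ : E →L[ℂ] ℂ) :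
    Continuous fun p : (E →L[ℂ] E) × ℂ × E => bordered R μ₀ φ p.1 p.2.1 p.2.2 := by
  have : Continuous fun p : (E →L[ℂ] E) × ℂ × E =>
      (ContinuousLinearMap.snd ℂ E ℂ).smulRight p.2.2 :=
    ((ContinuousLinearMap.smulRightL ℂ (E × ℂ) E (.snd ℂ E ℂ)).continuous).comp (by fun_prop)
  unfold bordered pencil
  fun_prop

theorem isUnit_bordered [CompleteSpace E] (hR : IsResolventAt A μ₀ R) (hμ₀ : μ₀ ≠ l)
    (hpole : IsPoleOfResolvent A l) (hsimple : IsAlgSimple A l) (hv : IsEigenvector A l v)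
    (hφ : φ v = 1) : IsUnit (bordered R μ₀ φ 0 l v) := by
  have hRv := resolvent_smul_eigenvector hR hv
  have hpv := pencil_zero_smul_eigenvector hRv
  rw [ContinuousLinearMap.isUnit_iff_bijective]
  constructor
  · refine (injective_iff_map_eq_zero _).2 fun ⟨y, τ⟩ h => ?_
    obtain ⟨hy, hφy⟩ : pencil R μ₀ 0 l y + τ • v = 0 ∧ φ (R y) = 0 := by
      simpa [bordered_apply] using h
    have hker : R y ∈ kerPow A l 2 := by
      rw [resolvent_mem_kerPow_succ_unperturbed hR, eq_neg_of_add_eq_zero_left hy]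
      exact neg_mem (Submodule.smul_mem _ _ hv.mem_kerPow_one)
    obtain ⟨a, ha⟩ := hsimple.exists_smul_eq hv hker
    obtain rfl : a = 0 := by simpa [← ha, hφ] using hφy
    obtain rfl : y = 0 := (map_eq_zero_iff R hR.injective).1 (by simpa using ha.symm)
    simpa [hv.1] using hy
  · rintro ⟨x, a⟩
    obtain ⟨y, τ, hy⟩ := exists_pencil_add_smul_eq hR hμ₀ hpole hsimple hv x
    refine ⟨(y + (a - φ (R y)) • (μ₀ - l) • v, τ), ?_⟩
    simp only [bordered_apply, map_add, map_smul, hpv, hRv]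
    simp [hy, hφ]

theorem isAlgSimple_of_injective_bordered (hR : IsResolventAt A μ₀ R)
    (hv : IsEigenvector (perturb A (relPerturbation A μ₀ b)) μ v) (hφ : φ v = 1)
    (hinj : Function.Injective (bordered R μ₀ φ b μ v)) :
    IsAlgSimple (perturb A (relPerturbation A μ₀ b)) μ := by
  obtain ⟨y, rfl⟩ := hR.exists_apply_of_mem_domain hv.2.1
  have hy := ((isEigenvector_resolvent_iff hR).1 hv).2
  refine isAlgSimple_of_kerPow_le_span hv fun m => ?_
  induction m with
  | zero => exact bot_le
  | succ m ih =>
    intro x hx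
    obtain ⟨z, rfl⟩ := hR.exists_apply_of_mem_domain (mem_kerPow_succ.1 hx).1
    obtain ⟨a, ha⟩ := Submodule.mem_span_singleton.1 (ih ((resolvent_mem_kerPow_succ hR).1 hx))
    have hzero : bordered R μ₀ φ b μ (R y) (z - φ (R z) • y, -a) = 0 := by
      simp [bordered_apply, hy, ha, hφ]
    have hz : z = φ (R z) • y :=
      sub_eq_zero.1 (Prod.ext_iff.1 (hinj (hzero.trans (map_zero _).symm))).1
    rw [hz, map_smul]
    exact Submodule.smul_mem _ _ (Submodule.mem_span_singleton_self _)

/-- The solution `(y, τ)` of the bordered system `pencil y + τ v = 0`, `φ (R y) = 1`, as a function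
of the perturbation and the spectral parameter; junk where the bordered operator is not
invertible. -/
noncomputable def borderedSolution (R : E →L[ℂ] E) (μ₀ : ℂ) (φ : E →L[ℂ] ℂ) (v : E)
    (p : (E →L[ℂ] E) × ℂ) : E × ℂ := Ring.inverse (bordered R μ₀ φ p.1 p.2 v) (0, 1)

theorem bordered_eq_iff_eq_borderedSolution (h : IsUnit (bordered R μ₀ φ b μ v)) {q : E × ℂ} :
    bordered R μ₀ φ b μ v q = (0, 1) ↔ q = borderedSolution R μ₀ φ v (b, μ) := by
  constructor
  · intro hq
    rw [borderedSolution, ← hq]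
    exact congr($(Ring.inverse_mul_cancel _ h) q).symm
  · rintro rfl
    exact congr($(Ring.mul_inverse_cancel _ h) (0, 1))

theorem pencil_add_smul_borderedSolution (h : IsUnit (bordered R μ₀ φ b μ v)) :
    pencil R μ₀ b μ (borderedSolution R μ₀ φ v (b, μ)).1 +
      (borderedSolution R μ₀ φ v (b, μ)).2 • v = 0 := by
  simpa [bordered_apply] using
    congr($((bordered_eq_iff_eq_borderedSolution h).2 rfl).1)

theorem functional_borderedSolution (h : IsUnit (bordered R μ₀ φ b μ v)) :
    φ (R (borderedSolution R μ₀ φ v (b, μ)).1) = 1 := by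
  simpa [bordered_apply] using
    congr($((bordered_eq_iff_eq_borderedSolution h).2 rfl).2)

theorem contDiffAt_borderedSolution [CompleteSpace E] (h : IsUnit (bordered R μ₀ φ b μ v)) :
    ContDiffAt ℂ 1 (borderedSolution R μ₀ φ v) (b, μ) := by
  obtain ⟨u, hu⟩ := h
  have hinv : ContDiffAt ℂ 1 (Ring.inverse (M₀ := E × ℂ →L[ℂ] E × ℂ))
      (bordered R μ₀ φ (b, μ).1 (b, μ).2 v) := hu ▸ contDiffAt_ringInverse ℂ u
  exact (hinv.comp (b, μ) (contDiff_bordered R μ₀ φ v).contDiffAt).clm_apply contDiffAt_const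

theorem isEigenvector_borderedSolution (hR : IsResolventAt A μ₀ R)
    (h : IsUnit (bordered R μ₀ φ b μ v)) (hτ : (borderedSolution R μ₀ φ v (b, μ)).2 = 0) :
    IsEigenvector (perturb A (relPerturbation A μ₀ b)) μ
      (R (borderedSolution R μ₀ φ v (b, μ)).1) := by
  refine (isEigenvector_resolvent_iff hR).2 ⟨fun hy => ?_, ?_⟩
  · simpa [hy] using functional_borderedSolution h
  · simpa [hτ] using pencil_add_smul_borderedSolution h

theorem borderedSolution_snd_eq_zero [CompleteSpace E] (hR : IsResolventAt A μ₀ R)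
    (h : IsUnit (bordered R μ₀ φ b μ v))
    (hμ : IsEigenvalue (perturb A (relPerturbation A μ₀ b)) μ) :
    (borderedSolution R μ₀ φ v (b, μ)).2 = 0 := by
  obtain ⟨y, hy0, hy⟩ := (isEigenvalue_perturb_iff hR).1 hμ
  have hinj := (ContinuousLinearMap.isUnit_iff_bijective.1 h).1
  have hφy : φ (R y) ≠ 0 := fun h0 => hy0 <| by
    have hzero : bordered R μ₀ φ b μ v (y, 0) = 0 := by simp [bordered_apply, hy, h0]
    exact congr($((map_eq_zero_iff _ hinj).1 hzero).1)
  have hsol : bordered R μ₀ φ b μ v ((φ (R y))⁻¹ • y, 0) = (0, 1) := by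
    simp [bordered_apply, hy, hφy]
  rw [← (bordered_eq_iff_eq_borderedSolution h).1 hsol]

theorem borderedSolution_of_isEigenvector (hR : IsResolventAt A μ₀ R)
    (h : IsUnit (bordered R μ₀ φ b μ v))
    (hy : IsEigenvector (perturb A (relPerturbation A μ₀ b)) μ (R y)) (hφ : φ (R y) = 1) :
    borderedSolution R μ₀ φ v (b, μ) = (y, 0) :=
  ((bordered_eq_iff_eq_borderedSolution h).1 (by
    simp [bordered_apply, ((isEigenvector_resolvent_iff hR).1 hy).2, hφ])).symm

theorem eventually_isUnit_bordered [CompleteSpace E] (h : IsUnit (bordered R μ₀ φ b μ v)) :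
    ∀ᶠ p : (E →L[ℂ] E) × ℂ × E in 𝓝 (b, μ, v), IsUnit (bordered R μ₀ φ p.1 p.2.1 p.2.2) :=
  (continuous_bordered R μ₀ φ).continuousAt.eventually (Units.isOpen.mem_nhds h)

theorem hasDerivAt_borderedSolution_snd [CompleteSpace E] (h : IsUnit (bordered R μ₀ φ b μ v))
    (hv : R (borderedSolution R μ₀ φ v (b, μ)).1 = v) :
    HasDerivAt (fun z => (borderedSolution R μ₀ φ v (b, z)).2) (-1) μ := by
  have hunit : ∀ᶠ z in 𝓝 μ, IsUnit (bordered R μ₀ φ b z v) :=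
    (show ContinuousAt (fun z : ℂ => (b, z, v)) μ by fun_prop).eventually
      (eventually_isUnit_bordered h)
  obtain ⟨⟨y', τ'⟩, hs⟩ : ∃ s', HasDerivAt (fun z => borderedSolution R μ₀ φ v (b, z)) s' μ :=
    ⟨_, (((contDiffAt_borderedSolution h).differentiableAt one_ne_zero).comp μ
      (by fun_prop : DifferentiableAt ℂ (fun z : ℂ => (b, z)) μ)).hasDerivAt⟩
  have hvec : HasDerivAt (fun z => R (borderedSolution R μ₀ φ v (b, z)).1) (R y') μ :=
    R.hasFDerivAt.comp_hasDerivAt μ hs.fst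
  have hsnd : HasDerivAt (fun z => (borderedSolution R μ₀ φ v (b, z)).2) τ' μ :=
    (ContinuousLinearMap.snd ℂ E ℂ).hasFDerivAt.comp_hasDerivAt μ hs
  have hpencil : v + pencil R μ₀ b μ y' + τ' • v = 0 := by
    have hsum := ((hasDerivAt_pencil R μ₀ b μ).clm_apply hs.fst).add (hsnd.smul_const v)
    rw [hv] at hsum
    exact hsum.unique ((hasDerivAt_const μ 0).congr_of_eventuallyEq
      (hunit.mono fun z hz => pencil_add_smul_borderedSolution hz))
  have hφ : φ (R y') = 0 := (φ.hasFDerivAt.comp_hasDerivAt μ hvec).unique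
    ((hasDerivAt_const μ 1).congr_of_eventuallyEq
      (hunit.mono fun z hz => functional_borderedSolution hz))
  have hker : bordered R μ₀ φ b μ v (y', τ' + 1) = 0 := by
    rw [bordered_apply, hφ, Prod.mk_eq_zero]
    exact ⟨by rw [← hpencil]; module, rfl⟩
  have hinj := (ContinuousLinearMap.isUnit_iff_bijective.1 h).1
  have hτ : τ' + 1 = 0 := congr($((map_eq_zero_iff _ hinj).1 hker).2)
  rwa [← eq_neg_of_add_eq_zero_left hτ]

/-- A branch of eigenpairs `(R (y b), lam b)` of the perturbed operators, issuing from the eigenpair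
`(v, l)` of `A`. The vectors are parametrised by their images under `μ₀ - A`, so that the branch is
smooth for the graph norm. -/
structure IsEigenBranch (A : E →ₗ.[ℂ] E) (μ₀ : ℂ) (R : E →L[ℂ] E) (l : ℂ) (v : E)
    (y : (E →L[ℂ] E) → E) (lam : (E →L[ℂ] E) → ℂ) : Prop where
  contDiffAt_vec : ContDiffAt ℂ 1 y 0
  contDiffAt_val : ContDiffAt ℂ 1 lam 0
  vec_zero : R (y 0) = v
  val_zero : lam 0 = l
  eventually_isEigenvector :
    ∀ᶠ b in 𝓝 0, IsEigenvector (perturb A (relPerturbation A μ₀ b)) (lam b) (R (y b))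
  eventually_isAlgSimple : ∀ᶠ b in 𝓝 0, IsAlgSimple (perturb A (relPerturbation A μ₀ b)) (lam b)
  eventually_eq : ∀ᶠ p : (E →L[ℂ] E) × ℂ in 𝓝 (0, l),
    IsEigenvalue (perturb A (relPerturbation A μ₀ p.1)) p.2 → p.2 = lam p.1

theorem exists_implicit_eigenvalue [CompleteSpace E] (h : IsUnit (bordered R μ₀ φ b μ v))
    (hv : R (borderedSolution R μ₀ φ v (b, μ)).1 = v)
    (hτ : (borderedSolution R μ₀ φ v (b, μ)).2 = 0) :
    ∃ lam : (E →L[ℂ] E) → ℂ, ContDiffAt ℂ 1 lam b ∧ lam b = μ ∧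
      (∀ᶠ b' in 𝓝 b, (borderedSolution R μ₀ φ v (b', lam b')).2 = 0) ∧
      ∀ᶠ p in 𝓝 (b, μ), (borderedSolution R μ₀ φ v p).2 = 0 → p.2 = lam p.1 := by
  have hsmooth : ContDiffAt ℂ 1 (fun p => (borderedSolution R μ₀ φ v p).2) (b, μ) :=
    (contDiffAt_borderedSolution h).snd
  set f' := fderiv ℂ (fun p => (borderedSolution R μ₀ φ v p).2) (b, μ)
  have hf' : f' ∘L .inr ℂ (E →L[ℂ] E) ℂ = (ContinuousLinearEquiv.neg ℂ : ℂ ≃L[ℂ] ℂ) := by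
    refine ContinuousLinearMap.ext_ring ?_
    have hcomp := (hsmooth.differentiableAt one_ne_zero).hasFDerivAt.comp_hasDerivAt μ
      ((hasDerivAt_const μ b).prodMk (hasDerivAt_id' μ))
    simpa using hcomp.unique (hasDerivAt_borderedSolution_snd h hv)
  have hinv : (f' ∘L .inr ℂ (E →L[ℂ] E) ℂ).IsInvertible := ⟨_, hf'.symm⟩
  refine ⟨hsmooth.implicitFunction one_ne_zero hinv, hsmooth.contDiffAt_implicitFunction _ _,
    hsmooth.implicitFunction_apply_self _ _, ?_, ?_⟩
  · filter_upwards [hsmooth.eventually_apply_implicitFunction one_ne_zero hinv] with b' hb'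
    exact hb'.trans hτ
  · filter_upwards [hsmooth.eventually_apply_eq_iff_implicitFunction one_ne_zero hinv] with p hp h0
    exact (hp.1 (h0.trans hτ.symm)).symm

theorem exists_isEigenBranch [CompleteSpace E] (hR : IsResolventAt A μ₀ R) (hμ₀ : μ₀ ≠ l)
    (hpole : IsPoleOfResolvent A l) (hsimple : IsAlgSimple A l) (hv : IsEigenvector A l v) :
    ∃ y lam, IsEigenBranch A μ₀ R l v y lam := by
  obtain ⟨φ, hφ⟩ := SeparatingDual.exists_eq_one (R := ℂ) hv.1
  have hunit := isUnit_bordered hR hμ₀ hpole hsimple hv hφ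
  have hsol : borderedSolution R μ₀ φ v (0, l) = ((μ₀ - l) • v, 0) := by
    apply borderedSolution_of_isEigenvector hR hunit <;>
      simpa [resolvent_smul_eigenvector hR hv, perturb_relPerturbation_zero]
  obtain ⟨lam, hlam, hlam0, hzero, hunique⟩ := exists_implicit_eigenvalue hunit
    (by rw [hsol, resolvent_smul_eigenvector hR hv]) (by rw [hsol])
  let y (b : E →L[ℂ] E) : E := (borderedSolution R μ₀ φ v (b, lam b)).1
  have hy : ContDiffAt ℂ 1 y 0 := by
    have hpair : ContDiffAt ℂ 1 (fun b => (b, lam b)) 0 := contDiffAt_id.prodMk hlam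
    exact (ContDiffAt.comp (0 : E →L[ℂ] E) (by rw [hlam0]; exact contDiffAt_borderedSolution hunit)
      hpair).fst
  have hy0 : R (y 0) = v := by simp [y, hlam0, hsol, resolvent_smul_eigenvector hR hv]
  have hunit_pair : ∀ᶠ p : (E →L[ℂ] E) × ℂ in 𝓝 (0, l), IsUnit (bordered R μ₀ φ p.1 p.2 v) :=
    (show ContinuousAt (fun p : (E →L[ℂ] E) × ℂ => (p.1, p.2, v)) (0, l) by fun_prop).eventually
      (eventually_isUnit_bordered hunit)
  have hlam_tendsto : Tendsto (fun b => (b, lam b)) (𝓝 0) (𝓝 (0, l)) := by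
    simpa [hlam0] using (continuousAt_id.prodMk hlam.continuousAt).tendsto
  have hvec_tendsto : Tendsto (fun b => (b, lam b, R (y b))) (𝓝 0) (𝓝 (0, l, v)) := by
    simpa [hlam0, hy0] using (continuousAt_id.prodMk (hlam.continuousAt.prodMk
      (R.continuous.continuousAt.comp hy.continuousAt))).tendsto
  have heig : ∀ᶠ b in 𝓝 0,
      IsEigenvector (perturb A (relPerturbation A μ₀ b)) (lam b) (R (y b)) := by
    filter_upwards [hzero, hlam_tendsto.eventually hunit_pair] with b hb hbu
    exact isEigenvector_borderedSolution hR hbu hb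
  refine ⟨y, lam, hy, hlam, hy0, hlam0, heig, ?_, ?_⟩
  · filter_upwards [heig, hlam_tendsto.eventually hunit_pair,
      hvec_tendsto.eventually (eventually_isUnit_bordered hunit)] with b hb hbu hbv
    exact isAlgSimple_of_injective_bordered hR hb (functional_borderedSolution hbu)
      (ContinuousLinearMap.isUnit_iff_bijective.1 hbv).1
  · filter_upwards [hunique, hunit_pair] with p hp hpu hμ
    exact hp (borderedSolution_snd_eq_zero hR hpu hμ)

theorem IsEigenBranch.eventually_forall_mem_eq [CompleteSpace E] {y : (E →L[ℂ] E) → E}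
    {lam : (E →L[ℂ] E) → ℂ} (h : IsEigenBranch A μ₀ R l v y lam) (hR : IsResolventAt A μ₀ R)
    {K : Set ℂ} (hK : IsCompact K) (hres : K \ {l} ⊆ resolventSet A) :
    ∀ᶠ b in 𝓝 (0 : E →L[ℂ] E), ∀ μ ∈ K,
      IsEigenvalue (perturb A (relPerturbation A μ₀ b)) μ → μ = lam b := by
  refine hK.eventually_forall_of_forall_eventually fun μ hμ => ?_
  rcases eq_or_ne μ l with rfl | hμl
  · exact h.eventually_eq
  · have hcont : Continuous fun p : (E →L[ℂ] E) × ℂ => pencil R μ₀ p.1 p.2 := by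
      unfold pencil; fun_prop
    filter_upwards [hcont.continuousAt.eventually
      (Units.isOpen.mem_nhds (isUnit_pencil_zero hR (hres ⟨hμ, hμl⟩)))] with p hp hpμ
    obtain ⟨y, hy0, hy⟩ := (isEigenvalue_perturb_iff hR).1 hpμ
    exact absurd ((map_eq_zero_iff _ (ContinuousLinearMap.isUnit_iff_bijective.1 hp).1).1 hy) hy0

end UnboundedOp

/-! ### Orbits of differentiable semigroups -/

section Integral

open MeasureTheory

variable {U : Type*} [NormedAddCommGroup U]

theorem intervalIntegrable_and_integral_norm_le_of_tail_le {f : ℝ → U} {g : ℝ → ℝ} {a t L : ℝ}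
    (hat : a < t) (hf : ContinuousOn f (Ioi a)) (hg : Tendsto g (𝓝[>] a) (𝓝 L))
    (hfg : ∀ s ∈ Ioo a t, ∫ r in s..t, ‖f r‖ ≤ g s) :
    IntervalIntegrable f volume a t ∧ ∫ r in a..t, ‖f r‖ ≤ L := by
  obtain ⟨s, -, hs, hlim⟩ := exists_seq_strictAnti_tendsto' hat
  have hgs : Tendsto (fun n => g (s n)) atTop (𝓝 L) :=
    hg.comp (tendsto_nhdsWithin_iff.2 ⟨hlim, Eventually.of_forall fun n => (hs n).1⟩)
  have hint : IntegrableOn f (Ioc a t) := by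
    refine integrableOn_Ioc_of_intervalIntegral_norm_bounded_left (I := L + 1) (l := atTop)
      (fun n => ?_) hlim ?_
    · rw [← intervalIntegrable_iff_integrableOn_Ioc_of_le (hs n).2.le]
      exact (hf.mono fun r hr => (hs n).1.trans_le hr.1).intervalIntegrable_of_Icc (hs n).2.le
    · filter_upwards [hgs.eventually_le_const (lt_add_one L)] with n hn
      rw [← intervalIntegral.integral_of_le (hs n).2.le]
      exact (hfg _ (hs n)).trans hn
  have hprimitive : ContinuousOn (fun c => ∫ r in c..t, ‖f r‖) (Icc a t) := by
    rw [← uIcc_of_le hat.le]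
    apply intervalIntegral.continuousOn_primitive_interval_left
    rw [uIcc_of_le hat.le, integrableOn_Icc_iff_integrableOn_Ioc]
    exact hint.norm
  have htail : Tendsto (fun n => ∫ r in s n..t, ‖f r‖) atTop (𝓝 (∫ r in a..t, ‖f r‖)) :=
    (hprimitive a ⟨le_rfl, hat.le⟩).tendsto.comp
      (tendsto_nhdsWithin_iff.2 ⟨hlim, Eventually.of_forall fun n => Ioo_subset_Icc_self (hs n)⟩)
  exact ⟨(intervalIntegrable_iff_integrableOn_Ioc_of_le hat.le).2 hint,
    le_of_tendsto_of_tendsto' htail hgs fun n => hfg _ (hs n)⟩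

theorem eq_exp_smul_add_integral_of_hasDerivAt [NormedSpace ℂ U] [CompleteSpace U] {g h : ℝ → U}
    {l : ℂ} {t : ℝ} (ht : 0 ≤ t) (hg : ContinuousOn g (Icc 0 t))
    (hderiv : ∀ s ∈ Ioo 0 t, HasDerivAt g (l • g s - h s) s)
    (hh : IntervalIntegrable h volume 0 t) :
    g 0 = Complex.exp (-l * t) • g t + ∫ s in (0 : ℝ)..t, Complex.exp (-l * s) • h s := by
  have hexp (s : ℝ) : HasDerivAt (fun s : ℝ => Complex.exp (-l * s))
      (Complex.exp (-l * s) * -l) s := by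
    simpa using ((Complex.ofRealCLM.hasDerivAt (x := s)).const_mul (-l)).cexp
  have hexp_cont : Continuous fun s : ℝ => Complex.exp (-l * s) := by fun_prop
  have key := intervalIntegral.integral_eq_sub_of_hasDerivAt_of_le ht
    (f := fun s : ℝ => Complex.exp (-l * s) • g s) (hexp_cont.continuousOn.smul hg)
    (fun s hs => ((hexp s).smul (hderiv s hs)).congr_deriv
      (show _ = -(Complex.exp (-l * s) • h s) by module))
    (hh.continuousOn_smul hexp_cont.continuousOn).neg
  simp only [intervalIntegral.integral_neg, Complex.ofReal_zero, mul_zero, Complex.exp_zero,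
    one_smul] at key
  linear_combination (norm := module) key

end Integral

namespace UnboundedOp

theorem evalAt_of_mem {E : Type*} [NormedAddCommGroup E] [NormedSpace ℂ E] {A : E →ₗ.[ℂ] E}
    (B : A.domain →ₗ[ℂ] E) {y : E} (h : y ∈ A.domain) : evalAt B y = B ⟨y, h⟩ := dif_pos h

end UnboundedOp

namespace C0Semigroup

open UnboundedOp MeasureTheory

variable {E : Type*} [NormedAddCommGroup E] [NormedSpace ℂ E] {S : C0Semigroup E}

theorem HasGen.exists_generator_eq {x y : E} (h : S.HasGen x y) :
    ∃ hx : x ∈ S.generator.domain, S.generator ⟨x, hx⟩ = y :=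
  ⟨⟨y, h⟩, tendsto_nhds_unique (S.hasGen_generator ⟨x, ⟨y, h⟩⟩) h⟩

theorem T_add_apply {s t : ℝ} (hs : 0 ≤ s) (ht : 0 ≤ t) (x : E) :
    S.T (s + t) x = S.T s (S.T t x) := congr($(S.map_add s t hs ht) x)

theorem T_zero_apply (x : E) : S.T 0 x = x := congr($S.map_zero x)

theorem HasGen.orbit {x y : E} (h : S.HasGen x y) {t : ℝ} (ht : 0 ≤ t) :
    S.HasGen (S.T t x) (S.T t y) := by
  refine (((S.T t).continuous.tendsto y).comp h).congr' ?_
  filter_upwards [self_mem_nhdsWithin] with s hs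
  simp only [Function.comp_apply, map_smul, map_sub]
  rw [← T_add_apply ht (le_of_lt hs), ← T_add_apply (le_of_lt hs) ht, add_comm]

theorem exists_generator_orbit (x : S.generator.domain) {t : ℝ} (ht : 0 ≤ t) :
    ∃ h : S.T t x ∈ S.generator.domain, S.generator ⟨S.T t x, h⟩ = S.T t (S.generator x) :=
  ((S.hasGen_generator x).orbit ht).exists_generator_eq

theorem exists_generator_eq_deriv (hdiff : S.ImmediatelyDifferentiable) (x : E) {t : ℝ}
    (ht : 0 < t) : ∃ h : S.T t x ∈ S.generator.domain,
      S.generator ⟨S.T t x, h⟩ = deriv (fun s => S.T s x) t := by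
  apply HasGen.exists_generator_eq
  have hslope := hasDerivAt_iff_tendsto_slope_zero.1 (hdiff x t ht).hasDerivAt
  refine (hslope.mono_left (nhdsWithin_mono _ fun s hs => ne_of_gt hs)).congr' ?_
  filter_upwards [self_mem_nhdsWithin] with s hs
  rw [Complex.coe_smul, ← T_add_apply (le_of_lt hs) ht.le, add_comm]

theorem hasDerivAt_orbit (hdiff : S.ImmediatelyDifferentiable) (x : S.generator.domain) {t : ℝ}
    (ht : 0 < t) : HasDerivAt (fun s => S.T s x) (S.T t (S.generator x)) t := by
  obtain ⟨_, hderiv⟩ := exists_generator_eq_deriv hdiff (x : E) ht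
  obtain ⟨_, horbit⟩ := exists_generator_orbit x ht.le
  rw [← horbit, hderiv]
  exact (hdiff x t ht).hasDerivAt

theorem continuousOn_orbit (hdiff : S.ImmediatelyDifferentiable) (x : E) :
    ContinuousOn (fun t => S.T t x) (Ici 0) := by
  intro t ht
  rcases eq_or_lt_of_le (show (0 : ℝ) ≤ t from ht) with rfl | h0
  · rw [← continuousWithinAt_Ioi_iff_Ici, ContinuousWithinAt, T_zero_apply]
    exact S.tendsto_zero x
  · exact (hdiff x t h0).continuousAt.continuousWithinAt

theorem continuousOn_deriv_orbit (hdiff : S.ImmediatelyDifferentiable) (x : E) :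
    ContinuousOn (fun t => deriv (fun s => S.T s x) t) (Ioi 0) := by
  intro t (ht : 0 < t)
  obtain ⟨hx, -⟩ := exists_generator_eq_deriv hdiff x (half_pos ht)
  set y := S.generator ⟨S.T (t / 2) x, hx⟩
  have hshift : (fun s => deriv (fun r => S.T r x) s) =ᶠ[𝓝 t] fun s => S.T (s - t / 2) y := by
    filter_upwards [Ioi_mem_nhds (show t / 2 < t by linarith)] with s (hs : t / 2 < s)
    have hderiv := (hasDerivAt_orbit hdiff ⟨_, hx⟩ (sub_pos.2 hs)).comp_sub_const s (t / 2)
    refine (hderiv.congr_of_eventuallyEq ?_).deriv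
    filter_upwards [Ioi_mem_nhds hs] with r (hr : t / 2 < r)
    rw [← T_add_apply (sub_nonneg.2 hr.le) (half_pos ht).le, sub_add_cancel]
  refine (ContinuousAt.congr ?_ hshift.symm).continuousWithinAt
  have hcont : ContinuousAt (fun s => S.T s y) (t - t / 2) :=
    (hdiff y _ (by linarith)).continuousAt
  exact ContinuousAt.comp (f := fun s => s - t / 2) hcont (by fun_prop)

section Perturbation

variable {b : E →L[ℂ] E} {μ₀ : ℂ}

theorem evalAt_relPerturbation_orbit (hdiff : S.ImmediatelyDifferentiable) (x : E) {t : ℝ}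
    (ht : 0 < t) : evalAt (relPerturbation S.generator μ₀ b) (S.T t x) =
      b (μ₀ • S.T t x - deriv (fun s => S.T s x) t) := by
  obtain ⟨h, hg⟩ := exists_generator_eq_deriv hdiff x ht
  rw [evalAt_of_mem _ h, relPerturbation_apply, hg]

theorem continuousOn_evalAt_relPerturbation_orbit (hdiff : S.ImmediatelyDifferentiable) (x : E) :
    ContinuousOn (fun t => evalAt (relPerturbation S.generator μ₀ b) (S.T t x)) (Ioi 0) := by
  refine ContinuousOn.congr (f := fun t => b (μ₀ • S.T t x - deriv (fun s => S.T s x) t)) ?_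
    fun t ht => evalAt_relPerturbation_orbit hdiff x ht
  exact b.continuous.comp_continuousOn ((((continuousOn_orbit hdiff x).mono
    Ioi_subset_Ici_self).const_smul μ₀).sub (continuousOn_deriv_orbit hdiff x))

theorem integral_norm_evalAt_orbit_tail_le (hdiff : S.ImmediatelyDifferentiable) {q t₀ : ℝ}
    (hadm : ∀ x ∈ S.generator.domain, ∫ s in (0 : ℝ)..t₀,
      ‖evalAt (relPerturbation S.generator μ₀ b) (S.T s x)‖ ≤ q * ‖x‖)
    (x : E) {a : ℝ} (ha : a ∈ Ioo 0 t₀) :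
    ∫ s in a..t₀, ‖evalAt (relPerturbation S.generator μ₀ b) (S.T s x)‖ ≤ q * ‖S.T a x‖ := by
  set f : ℝ → E := fun s => evalAt (relPerturbation S.generator μ₀ b) (S.T s x) with hf
  have hfi (c d : ℝ) (hc : 0 < c) (hcd : c ≤ d) : IntervalIntegrable f volume c d :=
    ((continuousOn_evalAt_relPerturbation_orbit hdiff x).mono
      fun s hs => hc.trans_le hs.1).intervalIntegrable_of_Icc hcd
  obtain ⟨ha0, hat⟩ := ha
  calc ∫ s in a..t₀, ‖f s‖
      ≤ (∫ s in a..t₀, ‖f s‖) + ∫ s in t₀..t₀ + a, ‖f s‖ := le_add_of_nonneg_right <|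
        intervalIntegral.integral_nonneg (by linarith) fun _ _ => norm_nonneg _
    _ = ∫ s in (0 : ℝ)..t₀, ‖f (s + a)‖ := by
        rw [intervalIntegral.integral_add_adjacent_intervals (hfi a t₀ ha0 hat.le).norm
          (hfi t₀ (t₀ + a) (ha0.trans hat) (by linarith)).norm,
          intervalIntegral.integral_comp_add_right (fun s => ‖f s‖), zero_add]
    _ = ∫ s in (0 : ℝ)..t₀,
          ‖evalAt (relPerturbation S.generator μ₀ b) (S.T s (S.T a x))‖ := by
        refine intervalIntegral.integral_congr fun s hs => ?_
        rw [uIcc_of_le (ha0.trans hat).le] at hs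
        simp only [hf, T_add_apply hs.1 ha0.le]
    _ ≤ q * ‖S.T a x‖ := hadm _ (exists_generator_eq_deriv hdiff x ha0).1

theorem Admissible.exists_eventually_integral_le (hdiff : S.ImmediatelyDifferentiable)
    (hadm : S.Admissible (relPerturbation S.generator μ₀ b)) :
    ∃ q < (1 : ℝ), ∀ᶠ t : ℝ in 𝓝[>] 0, ∀ x : E,
      IntervalIntegrable (fun s => evalAt (relPerturbation S.generator μ₀ b) (S.T s x))
        volume 0 t ∧
      ∫ s in (0 : ℝ)..t, ‖evalAt (relPerturbation S.generator μ₀ b) (S.T s x)‖ ≤ q * ‖x‖ := by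
  obtain ⟨q, t₀, -, hq, ht₀, hbound⟩ := hadm
  refine ⟨q, hq, ?_⟩
  filter_upwards [Ioc_mem_nhdsGT ht₀] with t ⟨ht, htt₀⟩ x
  obtain ⟨hint, hle⟩ := intervalIntegrable_and_integral_norm_le_of_tail_le ht₀
    (continuousOn_evalAt_relPerturbation_orbit hdiff x) ((S.tendsto_zero x).norm.const_mul q)
    fun a ha => integral_norm_evalAt_orbit_tail_le hdiff hbound x ha
  have hsub : uIcc 0 t ⊆ uIcc 0 t₀ := by
    rw [uIcc_of_le ht.le, uIcc_of_le ht₀.le]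
    exact Icc_subset_Icc_right htt₀
  exact ⟨hint.mono_set hsub, (intervalIntegral.integral_mono_interval le_rfl ht.le htt₀
    (ae_of_all _ fun _ => norm_nonneg _) hint.norm).trans hle⟩

theorem eq_exp_smul_orbit_add_integral [CompleteSpace E] (hdiff : S.ImmediatelyDifferentiable)
    {l : ℂ} {v : S.generator.domain} {w : E} (hw : S.generator v + w = l • (v : E)) {t : ℝ}
    (ht : 0 ≤ t) :
    (v : E) =
      Complex.exp (-l * t) • S.T t v + ∫ s in (0 : ℝ)..t, Complex.exp (-l * s) • S.T s w := by
  have hAv : S.generator v = l • (v : E) - w := eq_sub_of_add_eq hw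
  conv_lhs => rw [← T_zero_apply (S := S) (v : E)]
  refine eq_exp_smul_add_integral_of_hasDerivAt (g := fun s => S.T s v) ht
    ((continuousOn_orbit hdiff (v : E)).mono Icc_subset_Ici_self) (fun s hs => ?_)
    (((continuousOn_orbit hdiff w).mono Icc_subset_Ici_self).intervalIntegrable_of_Icc ht)
  simpa only [hAv, map_sub, map_smul] using hasDerivAt_orbit hdiff v hs.1

theorem relPerturbation_eq_exp_smul_orbit_add_integral [CompleteSpace E]
    (hdiff : S.ImmediatelyDifferentiable) {l : ℂ} {v : S.generator.domain} {w : E}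
    (hw : S.generator v + w = l • (v : E)) {t : ℝ} (ht : 0 ≤ t)
    (hint : IntervalIntegrable (fun s => evalAt (relPerturbation S.generator μ₀ b) (S.T s w))
      volume 0 t) :
    relPerturbation S.generator μ₀ b v =
      Complex.exp (-l * t) • evalAt (relPerturbation S.generator μ₀ b) (S.T t v) +
      ∫ s in (0 : ℝ)..t,
        Complex.exp (-l * s) • evalAt (relPerturbation S.generator μ₀ b) (S.T s w) := by
  have hAv : S.generator v = l • (v : E) - w := eq_sub_of_add_eq hw
  set y := μ₀ • (v : E) - S.generator v with hy
  obtain ⟨htv, hAtv⟩ := exists_generator_orbit v ht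
  have hBt : evalAt (relPerturbation S.generator μ₀ b) (S.T t v) = b (S.T t y) := by
    rw [evalAt_of_mem _ htv, relPerturbation_apply, hAtv, hy, map_sub (S.T t), map_smul (S.T t)]
  have hB0 : relPerturbation S.generator μ₀ b v = b (S.T 0 y) := by
    rw [T_zero_apply, relPerturbation_apply]
  rw [hB0, hBt]
  refine eq_exp_smul_add_integral_of_hasDerivAt (g := fun s => b (S.T s y)) ht
    (b.continuous.comp_continuousOn ((continuousOn_orbit hdiff y).mono Icc_subset_Ici_self))
    (fun s hs => ?_) hint
  have hv := hasDerivAt_orbit hdiff v hs.1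
  have hw' := (hdiff w s hs.1).hasDerivAt
  have horbit : HasDerivAt (fun r => S.T r y)
      (l • S.T s y - (μ₀ • S.T s w - deriv (fun r => S.T r w) s)) s := by
    have hy' : y = (μ₀ - l) • (v : E) + w := by rw [hy, hAv]; module
    simp only [hy', _root_.map_add, map_smul]
    refine ((hv.fun_const_smul (μ₀ - l)).fun_add hw').congr_deriv ?_
    rw [hAv, map_sub, map_smul]
    module
  have hb := (b.restrictScalars ℝ).hasFDerivAt.comp_hasDerivAt s horbit
  rw [evalAt_relPerturbation_orbit hdiff w hs.1]
  simpa only [ContinuousLinearMap.coe_restrictScalars', Function.comp_def,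
    map_sub, map_smul] using hb

end Perturbation

end C0Semigroup

/-! ### The principal ideal as a normed space -/

namespace LatticeCplx

variable {F : Type*} [NormedAddCommGroup F] [Lattice F] [HasSolidNorm F] [IsOrderedAddMonoid F]
  [NormedSpace ℝ F] [IsOrderedModule ℝ F] [CompleteSpace F]

theorem real_smul_re (a : ℝ) (z : LatticeCplx F) : (a • z).re = a • z.re := by
  rw [← Complex.coe_smul, smul_re, Complex.ofReal_re, Complex.ofReal_im, zero_smul, sub_zero]

theorem real_smul_im (a : ℝ) (z : LatticeCplx F) : (a • z).im = a • z.im := by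
  rw [← Complex.coe_smul, smul_im, Complex.ofReal_re, Complex.ofReal_im, zero_smul, add_zero]

theorem norm_rot_le (z : LatticeCplx F) (θ : ℝ) : ‖rot z.re z.im θ‖ ≤ ‖z‖ := by
  have hneg : -rot z.re z.im θ = rot z.re z.im (θ + Real.pi) := by
    simp only [rot, Real.cos_add_pi, Real.sin_add_pi]
    module
  rw [norm_eq, ← norm_abs_eq_norm]
  exact norm_le_of_le (abs_nonneg _)
    (abs_le'.2 ⟨rot_le_modulus z θ, hneg ▸ rot_le_modulus z (θ + Real.pi)⟩)

/-- The bounded real-linear map `z ↦ Re (e^{-iθ} z)`; the modulus is the pointwise supremum of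
these maps. -/
noncomputable def rotCLM (θ : ℝ) : LatticeCplx F →L[ℝ] F :=
  LinearMap.mkContinuous
    { toFun := fun z => rot z.re z.im θ
      map_add' := fun z w => by simp only [rot, add_re, add_im]; module
      map_smul' := fun a z => by
        simp only [rot, real_smul_re, real_smul_im, RingHom.id_apply]; module }
    1 fun z => (norm_rot_le z θ).trans_eq (one_mul _).symm

theorem rotCLM_apply (θ : ℝ) (z : LatticeCplx F) : rotCLM θ z = rot z.re z.im θ := rfl

theorem isClosed_setOf_modulus_le (x : F) : IsClosed {z : LatticeCplx F | z.modulus ≤ x} := by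
  have hInter : {z : LatticeCplx F | z.modulus ≤ x} = ⋂ θ, rotCLM θ ⁻¹' Iic x := by
    ext z
    simp only [mem_ofPred_eq, mem_iInter, mem_preimage, mem_Iic, rotCLM_apply]
    exact ⟨fun h θ => (rot_le_modulus z θ).trans h, modulus_le⟩
  rw [hInter]
  exact isClosed_iInter fun θ => isClosed_Iic.preimage (rotCLM θ).continuous

theorem modulus_zero : (0 : LatticeCplx F).modulus = 0 := by
  rw [← norm_eq_zero, ← norm_eq, norm_zero]

section IdealBound

variable {u : F} {z w : LatticeCplx F} {c d : ℝ}

theorem modulus_add_le_smul (hz : z.modulus ≤ c • u) (hw : w.modulus ≤ d • u) :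
    (z + w).modulus ≤ (c + d) • u := by
  rw [add_smul]
  exact (modulus_add_le z w).trans (add_le_add hz hw)

theorem modulus_smul_le_smul {a : ℂ} {k : ℝ} (ha : ‖a‖ ≤ k) (hz : z.modulus ≤ c • u) :
    (a • z).modulus ≤ (k * c) • u := by
  rw [mul_smul]
  calc (a • z).modulus ≤ ‖a‖ • z.modulus := modulus_smul_le a z
    _ ≤ k • z.modulus := smul_le_smul_of_nonneg_right ha (modulus_nonneg z)
    _ ≤ k • c • u := smul_le_smul_of_nonneg_left hz ((norm_nonneg a).trans ha)

theorem mem_principalIdeal_of_modulus_le (hu : 0 ≤ u) (hz : z.modulus ≤ c • u) :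
    z ∈ principalIdeal u :=
  ⟨max c 1, by positivity, hz.trans (smul_le_smul_of_nonneg_right (le_max_left c 1) hu)⟩

theorem gaugeNorm_nonneg (u : F) (z : LatticeCplx F) : 0 ≤ gaugeNorm u z :=
  Real.sInf_nonneg fun _ h => h.1.le

theorem gaugeNorm_le (hu : 0 ≤ u) (hc : 0 ≤ c) (hz : z.modulus ≤ c • u) : gaugeNorm u z ≤ c :=
  le_of_forall_pos_le_add fun ε hε => csInf_le ⟨0, fun _ h => h.1.le⟩
    ⟨by positivity, hz.trans (smul_le_smul_of_nonneg_right (by linarith) hu)⟩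

theorem modulus_le_gaugeNorm_smul (hu : 0 ≤ u) (hz : z ∈ principalIdeal u) :
    z.modulus ≤ gaugeNorm u z • u := by
  have hlim : Tendsto (fun a : ℝ => a • u) (𝓝[>] gaugeNorm u z) (𝓝 (gaugeNorm u z • u)) :=
    (tendsto_id.mono_left nhdsWithin_le_nhds).smul_const u
  refine ge_of_tendsto hlim ?_
  filter_upwards [self_mem_nhdsWithin] with a (ha : gaugeNorm u z < a)
  obtain ⟨c, ⟨-, hzc⟩, hca⟩ :=
    exists_lt_of_csInf_lt (s := {c : ℝ | 0 < c ∧ z.modulus ≤ c • u}) hz ha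
  exact hzc.trans (smul_le_smul_of_nonneg_right hca.le hu)

end IdealBound

section IdealSpace

variable {u : F}

variable (u) in
/-- The principal ideal `E_u` as a subspace. -/
def idealSubmodule (hu : 0 ≤ u) : Submodule ℂ (LatticeCplx F) where
  carrier := principalIdeal u
  add_mem' := fun ⟨_, _, hz⟩ ⟨_, _, hw⟩ =>
    mem_principalIdeal_of_modulus_le hu (modulus_add_le_smul hz hw)
  zero_mem' := mem_principalIdeal_of_modulus_le (c := 0) hu (by rw [modulus_zero, zero_smul])
  smul_mem' := fun _ _ ⟨_, _, hz⟩ =>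
    mem_principalIdeal_of_modulus_le hu (modulus_smul_le_smul le_rfl hz)

variable (u) in
/-- The principal ideal `E_u` with its gauge norm. It is a type synonym because
`idealSubmodule u hu` already carries the norm of the ambient lattice. -/
def IdealSpace (hu : 0 ≤ u) : Type _ := ↥(idealSubmodule u hu)

instance (hu : 0 ≤ u) : AddCommGroup (IdealSpace u hu) :=
  inferInstanceAs (AddCommGroup ↥(idealSubmodule u hu))

instance (hu : 0 ≤ u) : Module ℂ (IdealSpace u hu) :=
  inferInstanceAs (Module ℂ ↥(idealSubmodule u hu))

noncomputable instance (hu : 0 ≤ u) : Norm (IdealSpace u hu) := ⟨fun z => gaugeNorm u z.1⟩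

variable (u) in
/-- The gauge of `E_u` as a seminorm on `IdealSpace u hu`. -/
noncomputable def gaugeSeminorm (hu : 0 ≤ u) : Seminorm ℂ (IdealSpace u hu) :=
  Seminorm.ofSMulLE (fun z => gaugeNorm u z.1)
    (le_antisymm (gaugeNorm_le hu le_rfl (by rw [zero_smul]; exact modulus_zero.le))
      (gaugeNorm_nonneg u _))
    (fun z w => gaugeNorm_le hu (add_nonneg (gaugeNorm_nonneg u z.1) (gaugeNorm_nonneg u w.1))
      (modulus_add_le_smul (modulus_le_gaugeNorm_smul hu z.2) (modulus_le_gaugeNorm_smul hu w.2)))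
    fun a z => gaugeNorm_le hu (mul_nonneg (norm_nonneg a) (gaugeNorm_nonneg u z.1))
      (modulus_smul_le_smul le_rfl (modulus_le_gaugeNorm_smul hu z.2))

theorem idealSpace_normedSpaceCore (hu : 0 ≤ u) : NormedSpace.Core ℂ (IdealSpace u hu) where
  norm_nonneg z := gaugeNorm_nonneg u z.1
  norm_smul a z := (gaugeSeminorm u hu).smul' a z
  norm_triangle z w := (gaugeSeminorm u hu).add_le' z w
  norm_eq_zero_iff z := by
    refine ⟨fun h => Subtype.ext (norm_eq_zero.1 ?_), fun h => h ▸ (gaugeSeminorm u hu).map_zero'⟩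
    have hz := modulus_le_gaugeNorm_smul hu z.2
    rw [show gaugeNorm u z.1 = 0 from h, zero_smul] at hz
    rw [norm_eq, le_antisymm hz (modulus_nonneg _), norm_zero]

noncomputable instance (hu : 0 ≤ u) : NormedAddCommGroup (IdealSpace u hu) :=
  NormedAddCommGroup.ofCore (idealSpace_normedSpaceCore hu)

noncomputable instance (hu : 0 ≤ u) : NormedSpace ℂ (IdealSpace u hu) where
  norm_smul_le a z := ((idealSpace_normedSpaceCore hu).norm_smul a z).le

theorem exists_clm_idealSpace_norm_eq {V : Type*} [NormedAddCommGroup V] [NormedSpace ℂ V]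
    (hu : 0 ≤ u) {L : V →L[ℂ] LatticeCplx F} {k : ℝ}
    (hL : ∀ x, (L x).modulus ≤ (k * ‖x‖) • u) (hk : 0 ≤ k) :
    ∃ L' : V →L[ℂ] IdealSpace u hu, ∀ x, ‖L' x‖ = gaugeNorm u (L x) := by
  refine ⟨LinearMap.mkContinuous
    (L.toLinearMap.codRestrict (idealSubmodule u hu)
      fun x => mem_principalIdeal_of_modulus_le hu (hL x) : V →ₗ[ℂ] ↥(idealSubmodule u hu))
    k fun x => ?_, fun x => rfl⟩
  exact gaugeNorm_le hu (mul_nonneg hk (norm_nonneg x)) (hL x)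

end IdealSpace

end LatticeCplx

/-! ### Eigenvectors in the principal ideal -/

section Real

theorem norm_cexp_neg_mul_le {l : ℂ} {L s t : ℝ} (hl : ‖l‖ ≤ L) (hs : s ∈ Ioc 0 t) :
    ‖Complex.exp (-l * s)‖ ≤ Real.exp (L * t) := by
  rw [Complex.norm_exp]
  gcongr
  calc (-l * s : ℂ).re ≤ ‖(-l * s : ℂ)‖ := Complex.re_le_norm _
    _ = ‖l‖ * s := by rw [norm_mul, norm_neg, Complex.norm_real, Real.norm_of_nonneg hs.1.le]
    _ ≤ L * t := mul_le_mul hl hs.2 hs.1.le ((norm_nonneg l).trans hl)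

theorem tendsto_exp_mul_rpow_zero {γ : ℝ} (hγ : γ < 1) (L M : ℝ) :
    Tendsto (fun t => Real.exp (L * t) * (M * (t ^ (1 - γ) / (1 - γ)))) (𝓝[>] 0) (𝓝 0) := by
  have hpow := Real.continuous_rpow_const (sub_pos.2 hγ).le
  have hcont : Continuous fun t => Real.exp (L * t) * (M * (t ^ (1 - γ) / (1 - γ))) := by fun_prop
  simpa [Real.zero_rpow (sub_pos.2 hγ).ne'] using (hcont.tendsto 0).mono_left nhdsWithin_le_nhds

end Real

theorem mem_of_isFixedPt_of_contractingWith {α : Type*} [MetricSpace α] [CompleteSpace α]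
    {K : NNReal} {f : α → α} (hf : ContractingWith K f) {s : Set α} (hs : IsClosed s)
    (hne : s.Nonempty) (hsf : MapsTo f s s) {x : α} (hx : Function.IsFixedPt f x) : x ∈ s := by
  obtain ⟨y, hy⟩ := hne
  have : Nonempty α := ⟨y⟩
  rw [hf.fixedPoint_unique hx]
  exact hs.mem_of_tendsto (hf.tendsto_iterate_fixedPoint y)
    (Eventually.of_forall fun n => hsf.iterate n hy)

namespace C0Semigroup

open UnboundedOp MeasureTheory

variable {E : Type*} [NormedAddCommGroup E] [NormedSpace ℂ E] {S : C0Semigroup E}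
  {B : S.generator.domain →ₗ[ℂ] E} {l : ℂ} {t : ℝ}

/-- The operator `x ↦ ∫₀ᵗ e^{-ls} B T(s) x ds`. By Duhamel's formula, `B v` is a fixed point of a
translate of it whenever `(A + B) v = l v`. -/
noncomputable def volterra (B : S.generator.domain →ₗ[ℂ] E) (l : ℂ) (t : ℝ) (x : E) : E :=
  ∫ s in (0 : ℝ)..t, Complex.exp (-l * s) • evalAt B (S.T s x)

theorem intervalIntegrable_cexp_smul {f : ℝ → E} (hf : IntervalIntegrable f volume 0 t) (l : ℂ) :
    IntervalIntegrable (fun s : ℝ => Complex.exp (-l * s) • f s) volume 0 t :=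
  hf.continuousOn_smul (by fun_prop : Continuous fun s : ℝ => Complex.exp (-l * s)).continuousOn

theorem evalAt_orbit_sub (hdiff : S.ImmediatelyDifferentiable)
    (B : S.generator.domain →ₗ[ℂ] E) (x y : E) (ht : 0 < t) :
    evalAt B (S.T t (x - y)) = evalAt B (S.T t x) - evalAt B (S.T t y) := by
  obtain ⟨hx, -⟩ := exists_generator_eq_deriv hdiff x ht
  obtain ⟨hy, -⟩ := exists_generator_eq_deriv hdiff y ht
  rw [map_sub, evalAt_of_mem B hx, evalAt_of_mem B hy, evalAt_of_mem B (sub_mem hx hy)]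
  exact map_sub B ⟨_, hx⟩ ⟨_, hy⟩

theorem volterra_sub (hdiff : S.ImmediatelyDifferentiable) (ht : 0 ≤ t)
    (hint : ∀ x, IntervalIntegrable (fun s => evalAt B (S.T s x)) volume 0 t) (x y : E) :
    volterra B l t (x - y) = volterra B l t x - volterra B l t y := by
  rw [volterra, volterra, volterra, ← intervalIntegral.integral_sub
    (intervalIntegrable_cexp_smul (hint x) l) (intervalIntegrable_cexp_smul (hint y) l)]
  refine intervalIntegral.integral_congr_ae (ae_of_all _ fun s hs => ?_)
  rw [uIoc_of_le ht] at hs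
  rw [evalAt_orbit_sub hdiff B x y hs.1, smul_sub]

theorem norm_volterra_le {x : E} {q : ℝ} (ht : 0 ≤ t)
    (hint : IntervalIntegrable (fun s => evalAt B (S.T s x)) volume 0 t)
    (hq : ∫ s in (0 : ℝ)..t, ‖evalAt B (S.T s x)‖ ≤ q * ‖x‖) :
    ‖volterra B l t x‖ ≤ Real.exp (‖l‖ * t) * q * ‖x‖ := by
  calc ‖volterra B l t x‖
      ≤ ∫ s in (0 : ℝ)..t, Real.exp (‖l‖ * t) * ‖evalAt B (S.T s x)‖ := by
        refine intervalIntegral.norm_integral_le_of_norm_le ht (ae_of_all _ fun s hs => ?_)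
          (hint.norm.const_mul _)
        rw [norm_smul]
        gcongr
        exact norm_cexp_neg_mul_le le_rfl hs
    _ = Real.exp (‖l‖ * t) * ∫ s in (0 : ℝ)..t, ‖evalAt B (S.T s x)‖ :=
        intervalIntegral.integral_const_mul _ _
    _ ≤ Real.exp (‖l‖ * t) * (q * ‖x‖) := by gcongr
    _ = Real.exp (‖l‖ * t) * q * ‖x‖ := by ring

theorem contractingWith_add_volterra (hdiff : S.ImmediatelyDifferentiable) {q : ℝ} (ht : 0 ≤ t)
    (hq : ∀ x, IntervalIntegrable (fun s => evalAt B (S.T s x)) volume 0 t ∧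
      ∫ s in (0 : ℝ)..t, ‖evalAt B (S.T s x)‖ ≤ q * ‖x‖)
    (hqt : Real.exp (‖l‖ * t) * q < 1) (a : E) :
    ContractingWith (Real.exp (‖l‖ * t) * q).toNNReal fun x => a + volterra B l t x := by
  refine ⟨by simpa [Real.toNNReal_lt_one] using hqt, LipschitzWith.of_dist_le_mul fun x y => ?_⟩
  rw [dist_add_left, dist_eq_norm, dist_eq_norm, ← volterra_sub hdiff ht fun x => (hq x).1]
  refine (norm_volterra_le ht (hq _).1 (hq _).2).trans ?_
  gcongr
  exact Real.le_coe_toNNReal _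

end C0Semigroup

namespace LatticeCplx

open MeasureTheory UnboundedOp C0Semigroup

variable {F : Type*} [NormedAddCommGroup F] [Lattice F] [HasSolidNorm F] [IsOrderedAddMonoid F]
  [NormedSpace ℝ F] [IsOrderedModule ℝ F] [CompleteSpace F] {u : F}

theorem modulus_intervalIntegral_le {f : ℝ → LatticeCplx F} {g : ℝ → ℝ} {t : ℝ}
    (ht : 0 ≤ t) (hf : IntervalIntegrable f volume 0 t) (hg : IntervalIntegrable g volume 0 t)
    (hfg : ∀ s ∈ Ioc 0 t, (f s).modulus ≤ g s • u) :
    (∫ s in (0 : ℝ)..t, f s).modulus ≤ (∫ s in (0 : ℝ)..t, g s) • u := by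
  refine modulus_le fun θ => ?_
  rw [← rotCLM_apply, ← (rotCLM θ).intervalIntegral_comp_comm hf,
    ← intervalIntegral.integral_smul_const, intervalIntegral.integral_of_le ht,
    intervalIntegral.integral_of_le ht]
  rw [intervalIntegrable_iff_integrableOn_Ioc_of_le ht] at hf hg
  exact setIntegral_mono_on ((rotCLM θ).integrable_comp hf) (hg.smul_const u) measurableSet_Ioc
    fun s hs => (rot_le_modulus _ θ).trans (hfg s hs)

theorem modulus_integral_cexp_smul_le {f : ℝ → LatticeCplx F} {l : ℂ} {L M γ t : ℝ}
    (hl : ‖l‖ ≤ L) (hγ : γ < 1) (ht : 0 ≤ t) (hf : IntervalIntegrable f volume 0 t)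
    (hfM : ∀ s ∈ Ioc 0 t, (f s).modulus ≤ (M * s ^ (-γ)) • u) :
    (∫ s in (0 : ℝ)..t, Complex.exp (-l * s) • f s).modulus ≤
      (Real.exp (L * t) * (M * (t ^ (1 - γ) / (1 - γ)))) • u := by
  have hpow : ∫ s in (0 : ℝ)..t, s ^ (-γ) = t ^ (1 - γ) / (1 - γ) := by
    rw [integral_rpow (Or.inl (by linarith)), Real.zero_rpow (by linarith), sub_zero,
      neg_add_eq_sub]
  rw [← hpow, ← intervalIntegral.integral_const_mul, ← intervalIntegral.integral_const_mul]
  exact modulus_intervalIntegral_le ht (intervalIntegrable_cexp_smul hf l)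
    (((intervalIntegral.intervalIntegrable_rpow' (by linarith)).const_mul _).const_mul _)
    fun s hs => modulus_smul_le_smul (norm_cexp_neg_mul_le hl hs) (hfM s hs)

variable {S : C0Semigroup (LatticeCplx F)}

theorem Ultracontractive.exists_modulus_le (hS : Ultracontractive S u) (hu : 0 ≤ u) :
    ∃ C α : ℝ, 0 ≤ C ∧ 0 < α ∧ ∀ t ∈ Ioc (0 : ℝ) 1, ∀ x,
      (S.T t x).modulus ≤ (C * t ^ (-α) * ‖x‖) • u := by
  obtain ⟨C, α, hC, hα, hbound⟩ := hS
  exact ⟨C, α, zero_le_one.trans hC, hα, fun t ht x =>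
    (modulus_le_gaugeNorm_smul hu (hbound t ht x).1).trans
      (smul_le_smul_of_nonneg_right (hbound t ht x).2 hu)⟩

variable {B : S.generator.domain →ₗ[ℂ] LatticeCplx F}

theorem IdealBounds.exists_modulus_le (hB : IdealBounds S B u) (hu : 0 ≤ u)
    {x : LatticeCplx F} (hx : x ∈ principalIdeal u) :
    ∃ M : ℝ, ∀ t ∈ Ioc (0 : ℝ) 1, (S.T t x).modulus ≤ M • u := by
  obtain ⟨C, β, -, -, -, hbound⟩ := hB
  exact ⟨C * gaugeNorm u x, fun t ht =>
    (modulus_le_gaugeNorm_smul hu (hbound t ht x hx).1.1).trans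
      (smul_le_smul_of_nonneg_right (hbound t ht x hx).1.2 hu)⟩

theorem IdealBounds.exists_modulus_evalAt_le (hB : IdealBounds S B u) (hu : 0 ≤ u)
    (hdiff : S.ImmediatelyDifferentiable) :
    ∃ C β : ℝ, β < 1 ∧ ∀ t ∈ Ioc (0 : ℝ) 1, ∀ (m : ℝ) (x : LatticeCplx F), 0 ≤ m →
      x.modulus ≤ m • u → (evalAt B (S.T t x)).modulus ≤ (C * m * t ^ (-β)) • u := by
  obtain ⟨C, β, hC, -, hβ, hbound⟩ := hB
  refine ⟨C, β, hβ, fun t ht m x hm hx => ?_⟩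
  obtain ⟨hdom, -⟩ := exists_generator_eq_deriv hdiff x ht.1
  obtain ⟨hmem, hle⟩ := (hbound t ht x (mem_principalIdeal_of_modulus_le hu hx)).2 hdom
  have htβ : 0 ≤ t ^ (-β) := Real.rpow_nonneg ht.1.le _
  rw [evalAt_of_mem B hdom]
  refine (modulus_le_gaugeNorm_smul hu hmem).trans (smul_le_smul_of_nonneg_right ?_ hu)
  calc gaugeNorm u (B ⟨S.T t x, hdom⟩) ≤ C * t ^ (-β) * gaugeNorm u x := hle
    _ ≤ C * t ^ (-β) * m := by gcongr; exact gaugeNorm_le hu hm hx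
    _ = C * m * t ^ (-β) := by ring

theorem evalAt_orbit_mem_principalIdeal (hu : 0 ≤ u) (hdiff : S.ImmediatelyDifferentiable)
    (hS : Ultracontractive S u) (hB : IdealBounds S B u) (x : LatticeCplx F) {t : ℝ}
    (ht : t ∈ Ioc (0 : ℝ) 1) : evalAt B (S.T t x) ∈ principalIdeal u := by
  have hhalf : t / 2 ∈ Ioc (0 : ℝ) 1 := ⟨half_pos ht.1, by linarith [ht.1, ht.2]⟩
  obtain ⟨_, _, -, -, hS⟩ := hS
  obtain ⟨C, β, -, hB⟩ := hB.exists_modulus_evalAt_le hu hdiff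
  obtain ⟨m, hm, hxm⟩ := (hS (t / 2) hhalf x).1
  rw [← add_halves t, T_add_apply hhalf.1.le hhalf.1.le]
  exact mem_principalIdeal_of_modulus_le hu (hB (t / 2) hhalf m _ hm.le hxm)

theorem eigenvector_generator_mem_principalIdeal (hu : 0 ≤ u)
    (hdiff : S.ImmediatelyDifferentiable) (hS : Ultracontractive S u) {l : ℂ} {v : LatticeCplx F}
    (hv : IsEigenvector S.generator l v) : v ∈ principalIdeal u := by
  obtain ⟨-, hdom, hAv⟩ := hv
  obtain ⟨_, _, -, -, hS⟩ := hS.exists_modulus_le hu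
  have hduhamel : v = Complex.exp (-l * (1 : ℝ)) • S.T 1 v := by
    simpa only [_root_.map_zero, smul_zero, intervalIntegral.integral_zero, add_zero] using
      eq_exp_smul_orbit_add_integral hdiff (v := ⟨v, hdom⟩) (w := 0)
        (by rw [hAv, add_zero]) zero_le_one
  rw [hduhamel]
  exact mem_principalIdeal_of_modulus_le hu
    (modulus_smul_le_smul le_rfl (hS 1 ⟨one_pos, le_rfl⟩ v))

variable {b : LatticeCplx F →L[ℂ] LatticeCplx F} {μ₀ : ℂ}

-- The set `{|x| ≤ 2m u}` is closed and invariant under the contraction whose fixed point is `B v`.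
theorem relPerturbation_eigenvector_mem_principalIdeal (hu : 0 ≤ u)
    (hdiff : S.ImmediatelyDifferentiable) (hS : Ultracontractive S u)
    (hadm : S.Admissible (relPerturbation S.generator μ₀ b))
    (hideal : IdealBounds S (relPerturbation S.generator μ₀ b) u) {l : ℂ}
    {v : S.generator.domain}
    (hv : S.generator v + relPerturbation S.generator μ₀ b v = l • (v : LatticeCplx F)) :
    relPerturbation S.generator μ₀ b v ∈ principalIdeal u := by
  obtain ⟨q, hq, hbound⟩ := hadm.exists_eventually_integral_le hdiff
  obtain ⟨C, β, hβ, hB⟩ := hideal.exists_modulus_evalAt_le hu hdiff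
  obtain ⟨t, ⟨ht0, ht1⟩, hbound, hqt, hhalf⟩ : ∃ t ∈ Ioc (0 : ℝ) 1, (∀ x, _) ∧
      Real.exp (‖l‖ * t) * q < 1 ∧
      Real.exp (‖l‖ * t) * (C * (t ^ (1 - β) / (1 - β))) ≤ 1 / 2 := by
    have hexp : Tendsto (fun t => Real.exp (‖l‖ * t) * q) (𝓝[>] 0) (𝓝 q) := by
      have hcont : Continuous fun t => Real.exp (‖l‖ * t) * q := by fun_prop
      simpa using (hcont.tendsto 0).mono_left nhdsWithin_le_nhds
    have hpow := (tendsto_exp_mul_rpow_zero hβ ‖l‖ C).eventually_le_const one_half_pos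
    exact (Eventually.and (Ioc_mem_nhdsGT one_pos)
      (hbound.and ((hexp.eventually_lt_const hq).and hpow))).exists
  obtain ⟨m₀, hm₀, ham₀⟩ :=
    evalAt_orbit_mem_principalIdeal hu hdiff hS hideal (v : LatticeCplx F) ⟨ht0, ht1⟩
  have ham := modulus_smul_le_smul (le_refl ‖Complex.exp (-l * t)‖) ham₀
  set m := ‖Complex.exp (-l * t)‖ * m₀
  have hm : 0 ≤ 2 * m := by positivity
  have hfix := (relPerturbation_eq_exp_smul_orbit_add_integral hdiff hv ht0.le (hbound _).1).symm
  refine mem_principalIdeal_of_modulus_le hu (c := 2 * m) <|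
    mem_of_isFixedPt_of_contractingWith (contractingWith_add_volterra hdiff ht0.le hbound hqt _)
      (isClosed_setOf_modulus_le ((2 * m) • u)) ⟨0, ?_⟩ (fun x hx => ?_) hfix
  · exact modulus_zero.trans_le (smul_nonneg hm hu)
  · have hint := modulus_integral_cexp_smul_le (u := u) (le_refl ‖l‖) hβ ht0.le (hbound x).1
      fun s hs => hB s ⟨hs.1, hs.2.trans ht1⟩ (2 * m) x hm hx
    refine (modulus_add_le_smul ham hint).trans (smul_le_smul_of_nonneg_right ?_ hu)
    linear_combination 2 * m * hhalf

-- Ultracontractivity only gives the non-integrable rate `t ^ (-α)`. The pointwise bounds carry no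
-- rate in `t`, but Hartogs' lemma trades them for an arbitrarily small exponent.
theorem exists_modulus_orbit_le_rpow_of_pointwise_bounded (hu : 0 ≤ u) {C α : ℝ} (hC : 0 ≤ C)
    (hα : 0 < α) (hS : ∀ t ∈ Ioc (0 : ℝ) 1, ∀ x, (S.T t x).modulus ≤ (C * t ^ (-α) * ‖x‖) • u)
    {f : ℂ → LatticeCplx F} {z₀ : ℂ} {R N : ℝ} (hR : 0 < R)
    (hf : DifferentiableOn ℂ f (Metric.ball z₀ (2 * R)))
    (hfN : ∀ z ∈ Metric.ball z₀ (2 * R), ‖f z‖ ≤ N)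
    (hfu : ∀ z ∈ Metric.ball z₀ (2 * R), ∃ M : ℝ, ∀ t ∈ Ioc (0 : ℝ) 1,
      (S.T t (f z)).modulus ≤ M • u) {γ : ℝ} (hγ : 0 < γ) :
    ∃ K : ℝ, ∀ z ∈ Metric.ball z₀ R, ∀ t ∈ Ioc (0 : ℝ) 1,
      (S.T t (f z)).modulus ≤ (K * t ^ (-γ)) • u := by
  choose L hL using fun t : Ioc (0 : ℝ) 1 => exists_clm_idealSpace_norm_eq hu (hS t t.2)
    (mul_nonneg hC (Real.rpow_nonneg t.2.1.le _))
  set k := max 1 (C * N)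
  have hk : 1 ≤ k := le_max_left _ _
  have hrate : ∀ t : Ioc (0 : ℝ) 1, ∀ z ∈ Metric.ball z₀ (2 * R),
      ‖L t (f z)‖ ≤ k * (t : ℝ) ^ (-α) := fun t z hz => by
    have htα : 0 ≤ (t : ℝ) ^ (-α) := Real.rpow_nonneg t.2.1.le _
    calc ‖L t (f z)‖ = gaugeNorm u (S.T t (f z)) := hL t (f z)
      _ ≤ C * (t : ℝ) ^ (-α) * ‖f z‖ := gaugeNorm_le hu (by positivity) (hS t t.2 (f z))
      _ ≤ C * (t : ℝ) ^ (-α) * N := by gcongr; exact hfN z hz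
      _ = C * N * (t : ℝ) ^ (-α) := by ring
      _ ≤ k * (t : ℝ) ^ (-α) := by gcongr; exact le_max_right _ _
  have hptwise : ∀ z ∈ Metric.ball z₀ (2 * R), BddAbove (range fun t => ‖L t (f z)‖) := by
    intro z hz
    obtain ⟨M, hM⟩ := hfu z hz
    refine ⟨max M 0, forall_mem_range.2 fun t => (hL t (f z)).trans_le ?_⟩
    exact gaugeNorm_le hu (le_max_right _ _)
      ((hM t t.2).trans (smul_le_smul_of_nonneg_right (le_max_left _ _) hu))
  obtain ⟨m, hm⟩ := exists_norm_le_mul_rpow_of_pointwise_bounded hR (div_pos hγ hα)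
    (fun t => (L t).differentiable.comp_differentiableOn hf)
    (fun t => one_le_mul_of_one_le_of_one_le hk
      (Real.one_le_rpow_of_pos_of_le_one_of_nonpos t.2.1 t.2.2 (neg_nonpos.2 hα.le)))
    hrate hptwise
  refine ⟨m * k ^ (γ / α), fun z hz t ht => ?_⟩
  refine (modulus_le_gaugeNorm_smul hu (mem_principalIdeal_of_modulus_le hu (hS t ht (f z)))).trans
    (smul_le_smul_of_nonneg_right ?_ hu)
  calc gaugeNorm u (S.T t (f z)) ≤ m * (k * t ^ (-α)) ^ (γ / α) :=
        (hL ⟨t, ht⟩ (f z)).symm.trans_le (hm ⟨t, ht⟩ z hz)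
    _ = m * k ^ (γ / α) * t ^ (-γ) := by
        rw [Real.mul_rpow (zero_le_one.trans hk) (Real.rpow_nonneg ht.1.le _),
          ← Real.rpow_mul ht.1.le, neg_mul, mul_div_cancel₀ γ hα.ne', mul_assoc]

theorem Ultracontractive.eventually_modulus_orbit_le_rpow (hS : Ultracontractive S u) (hu : 0 ≤ u)
    {f : ℂ → LatticeCplx F} {z₀ : ℂ} (hf : ∀ᶠ z in 𝓝 z₀, DifferentiableAt ℂ f z)
    (hfu : ∀ᶠ z in 𝓝 z₀, ∃ M : ℝ, ∀ t ∈ Ioc (0 : ℝ) 1, (S.T t (f z)).modulus ≤ M • u)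
    {γ : ℝ} (hγ : 0 < γ) :
    ∃ K : ℝ, ∀ᶠ z in 𝓝 z₀, ∀ t ∈ Ioc (0 : ℝ) 1, (S.T t (f z)).modulus ≤ (K * t ^ (-γ)) • u := by
  obtain ⟨C, α, hC, hα, hS⟩ := hS.exists_modulus_le hu
  have hnorm : ∀ᶠ z in 𝓝 z₀, ‖f z‖ ≤ ‖f z₀‖ + 1 :=
    hf.self_of_nhds.continuousAt.norm.eventually_le_const (lt_add_one _)
  obtain ⟨ρ, hρ, hball⟩ := Metric.eventually_nhds_iff_ball.1 (hf.and (hfu.and hnorm))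
  rw [← mul_div_cancel₀ ρ two_ne_zero] at hball
  obtain ⟨K, hK⟩ := exists_modulus_orbit_le_rpow_of_pointwise_bounded hu hC hα hS (half_pos hρ)
    (fun z hz => (hball z hz).1.differentiableWithinAt) (fun z hz => (hball z hz).2.2)
    (fun z hz => (hball z hz).2.1) hγ
  exact ⟨K, Filter.mem_of_superset (Metric.ball_mem_nhds z₀ (half_pos hρ)) hK⟩

theorem Ultracontractive.eventually_modulus_orbit_le (hS : Ultracontractive S u) (hu : 0 ≤ u)
    {ι : Type*} {𝓕 : Filter ι} {d : ι → LatticeCplx F} (hd : Tendsto d 𝓕 (𝓝 0)) {t : ℝ}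
    (ht : t ∈ Ioc (0 : ℝ) 1) {ε : ℝ} (hε : 0 < ε) :
    ∀ᶠ i in 𝓕, (S.T t (d i)).modulus ≤ ε • u := by
  obtain ⟨C, α, -, -, hS⟩ := hS.exists_modulus_le hu
  have hlim : Tendsto (fun i => C * t ^ (-α) * ‖d i‖) 𝓕 (𝓝 0) := by
    simpa using hd.norm.const_mul (C * t ^ (-α))
  filter_upwards [hlim.eventually_le_const hε] with i hi
  exact (hS t ht (d i)).trans (smul_le_smul_of_nonneg_right hi hu)

theorem eventually_modulus_eigenvector_sub_le (hu : 0 ≤ u) (hdiff : S.ImmediatelyDifferentiable)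
    (hS : Ultracontractive S u) {ι : Type*} {𝓕 : Filter ι} {v : ι → S.generator.domain}
    {v₀ : S.generator.domain} {w : ι → LatticeCplx F} {l : ι → ℂ} {l₀ : ℂ}
    (hv : Tendsto (fun i => (v i : LatticeCplx F)) 𝓕 (𝓝 v₀)) (hl : Tendsto l 𝓕 (𝓝 l₀))
    (heq : ∀ᶠ i in 𝓕, S.generator (v i) + w i = l i • (v i : LatticeCplx F))
    (heq₀ : S.generator v₀ = l₀ • (v₀ : LatticeCplx F)) {K γ : ℝ} (hγ : γ < 1)
    (hw : ∀ᶠ i in 𝓕, ∀ t ∈ Ioc (0 : ℝ) 1, (S.T t (w i)).modulus ≤ (K * t ^ (-γ)) • u)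
    {ε : ℝ} (hε : 0 < ε) :
    ∀ᶠ i in 𝓕, (v i - v₀ : LatticeCplx F).modulus ≤ ε • u := by
  obtain ⟨t, ht, hint⟩ : ∃ t ∈ Ioc (0 : ℝ) 1,
      Real.exp ((‖l₀‖ + 1) * t) * (K * (t ^ (1 - γ) / (1 - γ))) ≤ ε / 2 :=
    (Eventually.and (Ioc_mem_nhdsGT one_pos)
      ((tendsto_exp_mul_rpow_zero hγ _ K).eventually_le_const (half_pos hε))).exists
  set d : ι → LatticeCplx F := fun i =>
    Complex.exp (-l i * t) • (v i : LatticeCplx F) - Complex.exp (-l₀ * t) • (v₀ : LatticeCplx F)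
  have hd : Tendsto d 𝓕 (𝓝 0) := by
    simpa [d] using (((hl.neg.mul_const (t : ℂ)).cexp.smul hv).sub_const
      (Complex.exp (-l₀ * t) • (v₀ : LatticeCplx F)))
  have hduhamel₀ : (v₀ : LatticeCplx F) = Complex.exp (-l₀ * t) • S.T t v₀ := by
    simpa only [_root_.map_zero, smul_zero, intervalIntegral.integral_zero, add_zero] using
      eq_exp_smul_orbit_add_integral hdiff (w := 0) (by rw [heq₀, add_zero]) ht.1.le
  filter_upwards [heq, hw, hS.eventually_modulus_orbit_le hu hd ht (half_pos hε),
    hl.norm.eventually_le_const (lt_add_one ‖l₀‖)] with i heq hw hdi hli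
  have hduhamel := eq_exp_smul_orbit_add_integral hdiff heq ht.1.le
  have hdecomp : (v i - v₀ : LatticeCplx F) =
      S.T t (d i) + ∫ s in (0 : ℝ)..t, Complex.exp (-l i * s) • S.T s (w i) := by
    rw [map_sub, map_smul, map_smul]
    linear_combination (norm := module) hduhamel - hduhamel₀
  have horbit : IntervalIntegrable (fun s => S.T s (w i)) volume 0 t :=
    ((continuousOn_orbit hdiff (w i)).mono
      Icc_subset_Ici_self).intervalIntegrable_of_Icc ht.1.le
  rw [hdecomp, ← add_halves ε]
  exact modulus_add_le_smul hdi <| (modulus_integral_cexp_smul_le hli hγ ht.1.le horbit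
    fun s hs => hw s ⟨hs.1, hs.2.trans ht.2⟩).trans (smul_le_smul_of_nonneg_right hint hu)

end LatticeCplx

/-! ### Real operators -/

namespace LatticeCplx

open UnboundedOp

section Conj

variable {F : Type*} [AddCommGroup F]

/-- Complex conjugation of `F + iF`. -/
def conj (z : LatticeCplx F) : LatticeCplx F := ⟨z.re, -z.im⟩

@[simp] theorem conj_re (z : LatticeCplx F) : (conj z).re = z.re := rfl

@[simp] theorem conj_im (z : LatticeCplx F) : (conj z).im = -z.im := rfl

@[simp] theorem ofReal_re (x : F) : (ofReal x).re = x := rfl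

@[simp] theorem ofReal_im (x : F) : (ofReal x).im = 0 := rfl

@[simp] theorem conj_eq_zero_iff {z : LatticeCplx F} : conj z = 0 ↔ z = 0 := by
  simp [LatticeCplx.ext_iff]

variable [Module ℝ F] {A : LatticeCplx F →ₗ.[ℂ] LatticeCplx F}

theorem conj_smul (a : ℂ) (z : LatticeCplx F) : conj (a • z) = starRingEnd ℂ a • conj z := by
  ext <;> simp only [conj_re, conj_im, smul_re, smul_im, Complex.conj_re, Complex.conj_im] <;>
    module

theorem ofReal_re_add_I_smul_ofReal_im (z : LatticeCplx F) :
    ofReal z.re + Complex.I • ofReal z.im = z := by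
  ext <;> simp

theorem ofReal_re_sub_I_smul_ofReal_im (z : LatticeCplx F) :
    ofReal z.re - Complex.I • ofReal z.im = conj z := by
  ext <;> simp

theorem IsRealOp.apply_re_im (hA : IsRealOp A) (z : A.domain) :
    A ⟨_, (hA.1 z z.2).1⟩ = ofReal (A z).re ∧ A ⟨_, (hA.1 z z.2).2⟩ = ofReal (A z).im := by
  obtain ⟨hre, him⟩ := hA.1 z z.2
  have hz : A z = A ⟨_, hre⟩ + Complex.I • A ⟨_, him⟩ := by
    rw [← A.map_smul, ← A.map_add]
    exact congrArg A (Subtype.ext (ofReal_re_add_I_smul_ofReal_im _).symm)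
  have hre0 := hA.2 _ hre
  have him0 := hA.2 _ him
  rw [hz]
  constructor <;> ext <;> simp [hre0, him0]

theorem IsRealOp.exists_apply_conj (hA : IsRealOp A) (z : A.domain) :
    ∃ h : conj (z : LatticeCplx F) ∈ A.domain, A ⟨conj z, h⟩ = conj (A z) := by
  obtain ⟨hre, him⟩ := hA.apply_re_im z
  have hconj := ofReal_re_sub_I_smul_ofReal_im (z : LatticeCplx F)
  refine ⟨hconj ▸ sub_mem (hA.1 z z.2).1 (A.domain.smul_mem _ (hA.1 z z.2).2), ?_⟩
  rw [← ofReal_re_sub_I_smul_ofReal_im (A z), ← hre, ← him, ← A.map_smul, ← A.map_sub]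
  exact congrArg A (Subtype.ext hconj.symm)

end Conj

section Eigenvector

variable {F : Type*} [NormedAddCommGroup F] [Lattice F] [HasSolidNorm F] [IsOrderedAddMonoid F]
  [NormedSpace ℝ F] [IsOrderedModule ℝ F] [CompleteSpace F]
  {A : LatticeCplx F →ₗ.[ℂ] LatticeCplx F} {v : LatticeCplx F}

theorem IsRealOp.perturb (hA : IsRealOp A) {B : A.domain →ₗ[ℂ] LatticeCplx F}
    (hB : IsRealOp (onDomain A B)) : IsRealOp (perturb A B) :=
  ⟨hA.1, fun x hx => by
    change (A ⟨ofReal x, hx⟩).im + (onDomain A B ⟨ofReal x, hx⟩).im = 0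
    rw [hA.2 x hx, hB.2 x hx, add_zero]⟩

theorem IsRealOp.isEigenvalue_conj (hA : IsRealOp A) {l : ℂ} (hl : IsEigenvalue A l) :
    IsEigenvalue A (starRingEnd ℂ l) := by
  obtain ⟨v, hv0, hdom, hv⟩ := hl
  obtain ⟨hdom', hconj⟩ := hA.exists_apply_conj ⟨v, hdom⟩
  exact ⟨conj v, conj_eq_zero_iff.not.2 hv0, hdom', by rw [hconj, hv, conj_smul]⟩

theorem IsRealOp.isEigenvector_ofReal_re (hA : IsRealOp A) {l : ℝ} (hv : IsEigenvector A l v)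
    (hre : v.re ≠ 0) : IsEigenvector A l (ofReal v.re) := by
  obtain ⟨-, hdom, hv⟩ := hv
  refine ⟨fun h => hre (congrArg re h), (hA.1 v hdom).1, ?_⟩
  rw [(hA.apply_re_im ⟨v, hdom⟩).1, hv]
  ext <;>
    simp only [ofReal_re, ofReal_im, smul_re, smul_im, Complex.ofReal_re, Complex.ofReal_im] <;>
    module

theorem modulus_ofReal_re_le (z : LatticeCplx F) : (ofReal z.re).modulus ≤ z.modulus :=
  (modulus_le_add _).trans (by simpa using abs_re_le z)

theorem IsRealOp.exists_isEigenvector_ge (hA : IsRealOp A) {u : F} (hu : 0 ≤ u) {l c : ℝ}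
    (hc : 0 < c) {v₀ : LatticeCplx F} (hv₀ : v₀ ≠ 0) (hv₀u : ofReal (c • u) ≤ v₀)
    (hv₀_mem : v₀ ∈ principalIdeal u) (hv : IsEigenvector A l v)
    (hsub : (v - v₀).modulus ≤ (c / 2) • u) :
    ∃ w ∈ principalIdeal u, IsEigenvector A l w ∧ ofReal ((c / 2) • u) ≤ w := by
  obtain ⟨k, -, hv₀k⟩ := hv₀_mem
  have hlower : (c / 2) • u ≤ v.re := by
    have hle : v₀.re - v.re ≤ (c / 2) • u := by
      rw [← neg_sub]
      exact (neg_le_abs _).trans ((abs_re_le (v - v₀)).trans hsub)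
    calc (c / 2) • u = c • u - (c / 2) • u := by module
      _ ≤ v₀.re - (c / 2) • u := sub_le_sub_right hv₀u.1 _
      _ ≤ v.re := sub_le_comm.1 hle
  have hre : v.re ≠ 0 := fun h => hv₀ <| by
    have hcu : (c / 2) • u = 0 :=
      le_antisymm (hlower.trans_eq h) (smul_nonneg (half_pos hc).le hu)
    rw [(smul_eq_zero_iff_right (half_pos hc).ne').1 hcu, smul_zero] at hv₀k
    rw [← norm_eq_zero, norm_eq, le_antisymm hv₀k (modulus_nonneg v₀), norm_zero]
  have hmodulus : v.modulus ≤ (c / 2 + k) • u := by simpa using modulus_add_le_smul hsub hv₀k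
  exact ⟨ofReal v.re, mem_principalIdeal_of_modulus_le hu ((modulus_ofReal_re_le v).trans hmodulus),
    hA.isEigenvector_ofReal_re hv hre, hlower, rfl⟩

end Eigenvector

end LatticeCplx

namespace UnboundedOp

theorem exists_differentiableOn_eq_relPerturbation {E : Type*} [NormedAddCommGroup E]
    [NormedSpace ℂ E] [CompleteSpace E] {A : E →ₗ.[ℂ] E} {μ₀ : ℂ} {R : E →L[ℂ] E}
    (hR : IsResolventAt A μ₀ R) {B : ℂ → A.domain →ₗ[ℂ] E} {s : Set ℂ} (hs : IsOpen s)
    (hbdd : ∀ κ ∈ s, ∃ M : ℝ, ∀ x : A.domain, ‖B κ x‖ ≤ M * (‖(x : E)‖ + ‖A x‖))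
    (hhol : ∀ x : A.domain, DifferentiableOn ℂ (fun κ => B κ x) s) :
    ∃ b : ℂ → E →L[ℂ] E, DifferentiableOn ℂ b s ∧ ∀ κ ∈ s, B κ = relPerturbation A μ₀ (b κ) := by
  have hex : ∀ κ, ∃ b : E →L[ℂ] E, κ ∈ s → B κ = relPerturbation A μ₀ b := fun κ => by
    by_cases hκ : κ ∈ s
    · obtain ⟨M, hM⟩ := hbdd κ hκ
      exact (exists_eq_relPerturbation hR hM).imp fun b hb _ => hb
    · exact ⟨0, fun h => absurd h hκ⟩
  choose b hb using hex
  refine ⟨b, differentiableOn_clm_of_apply hs fun y => ?_, hb⟩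
  refine (hhol ⟨R y, hR.mem_domain y⟩).congr fun κ hκ => ?_
  rw [hb κ hκ, relPerturbation_resolvent_apply hR]

theorem eq_zero_of_relPerturbation_eq_zero {E : Type*} [NormedAddCommGroup E]
    [NormedSpace ℂ E] {A : E →ₗ.[ℂ] E} {μ₀ : ℂ} {R : E →L[ℂ] E}
    (hR : IsResolventAt A μ₀ R) {b : E →L[ℂ] E} (hb : relPerturbation A μ₀ b = 0) : b = 0 := by
  ext y
  rw [← relPerturbation_resolvent_apply hR, hb]
  rfl

end UnboundedOp

/-! ### The real eigenpair -/

namespace UnboundedOp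

open LatticeCplx

variable {F : Type*} [NormedAddCommGroup F] [Lattice F] [HasSolidNorm F] [IsOrderedAddMonoid F]
  [NormedSpace ℝ F] [IsOrderedModule ℝ F] [CompleteSpace F]
  {R : LatticeCplx F →L[ℂ] LatticeCplx F} {μ₀ : ℂ} {v₀ : LatticeCplx F}
  {y : (LatticeCplx F →L[ℂ] LatticeCplx F) → LatticeCplx F}
  {lam : (LatticeCplx F →L[ℂ] LatticeCplx F) → ℂ}

-- The conjugate of an eigenvalue near the real `l₀` is again an eigenvalue near `l₀`, hence equal
-- to it by local uniqueness.
theorem IsEigenBranch.eventually_exists_ofReal_eq {A : LatticeCplx F →ₗ.[ℂ] LatticeCplx F} {l₀ : ℝ}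
    (h : IsEigenBranch A μ₀ R l₀ v₀ y lam) {r : ℝ} (hr : 0 < r) :
    ∀ᶠ b in 𝓝 0, IsRealOp (perturb A (relPerturbation A μ₀ b)) →
      ∃ l ∈ Ioo (l₀ - r) (l₀ + r), lam b = (l : ℝ) := by
  have hlam : Tendsto lam (𝓝 0) (𝓝 l₀) := h.val_zero ▸ h.contDiffAt_val.continuousAt.tendsto
  have hconj : Tendsto (fun b => (b, starRingEnd ℂ (lam b))) (𝓝 0) (𝓝 (0, (l₀ : ℂ))) := by
    rw [← Complex.conj_ofReal l₀]
    exact tendsto_id.prodMk_nhds ((Complex.continuous_conj.tendsto _).comp hlam)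
  have hre : Tendsto (fun b => (lam b).re) (𝓝 0) (𝓝 l₀) :=
    (Complex.continuous_re.tendsto _).comp hlam
  filter_upwards [hconj.eventually h.eventually_eq, h.eventually_isEigenvector,
    hre.eventually_mem (Ioo_mem_nhds (sub_lt_self l₀ hr) (lt_add_of_pos_right l₀ hr))]
    with b huniq heig hmem hreal
  exact ⟨(lam b).re, hmem,
    (Complex.conj_eq_iff_re.1 (huniq (hreal.isEigenvalue_conj ⟨_, heig⟩))).symm⟩

theorem IsEigenBranch.eventually_modulus_sub_le {S : C0Semigroup (LatticeCplx F)} {u : F} {l₀ : ℂ}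
    (h : IsEigenBranch S.generator μ₀ R l₀ v₀ y lam) (hR : IsResolventAt S.generator μ₀ R)
    (hu : 0 ≤ u) (hdiff : S.ImmediatelyDifferentiable) (hS : Ultracontractive S u)
    (hv₀ : IsEigenvector S.generator l₀ v₀) {b : ℂ → LatticeCplx F →L[ℂ] LatticeCplx F}
    (hb : ∀ᶠ κ in 𝓝 0, DifferentiableAt ℂ b κ) (hb₀ : b 0 = 0)
    (hadm : ∀ᶠ κ in 𝓝 0, S.Admissible (relPerturbation S.generator μ₀ (b κ)))
    (hideal : ∀ᶠ κ in 𝓝 0, IdealBounds S (relPerturbation S.generator μ₀ (b κ)) u)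
    {ε : ℝ} (hε : 0 < ε) :
    ∀ᶠ κ in 𝓝 0, (R (y (b κ)) - v₀).modulus ≤ ε • u := by
  have hb_tendsto : Tendsto b (𝓝 0) (𝓝 0) := hb₀ ▸ hb.self_of_nhds.continuousAt.tendsto
  have hlam : Tendsto (lam ∘ b) (𝓝 0) (𝓝 l₀) :=
    (h.val_zero ▸ h.contDiffAt_val.continuousAt.tendsto).comp hb_tendsto
  have hvec : Tendsto (fun κ => R (y (b κ))) (𝓝 0) (𝓝 v₀) :=
    h.vec_zero ▸
      (R.continuous.tendsto _).comp (h.contDiffAt_vec.continuousAt.tendsto.comp hb_tendsto)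
  have hy : ∀ᶠ κ in 𝓝 0, DifferentiableAt ℂ y (b κ) := hb_tendsto.eventually <|
    (h.contDiffAt_vec.eventually (by simp)).mono fun _ hy => hy.differentiableAt one_ne_zero
  have heig : ∀ᶠ κ in 𝓝 0, S.generator ⟨R (y (b κ)), hR.mem_domain _⟩ + b κ (y (b κ)) =
      lam (b κ) • R (y (b κ)) := by
    filter_upwards [hb_tendsto.eventually h.eventually_isEigenvector] with κ ⟨_, _, hκ⟩
    rw [← relPerturbation_resolvent_apply hR (b κ)]
    exact hκ
  have hdiff_w : ∀ᶠ κ in 𝓝 0, DifferentiableAt ℂ (fun κ => b κ (y (b κ))) κ := by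
    filter_upwards [hb, hy] with κ hbκ hyκ
    exact hbκ.clm_apply (hyκ.comp κ hbκ)
  have hbounded : ∀ᶠ κ in 𝓝 0, ∃ M : ℝ, ∀ t ∈ Ioc (0 : ℝ) 1,
      (S.T t (b κ (y (b κ)))).modulus ≤ M • u := by
    filter_upwards [heig, hadm, hideal] with κ hκ hadmκ hidealκ
    rw [← relPerturbation_resolvent_apply hR (b κ)] at hκ ⊢
    exact hidealκ.exists_modulus_le hu
      (relPerturbation_eigenvector_mem_principalIdeal hu hdiff hS hadmκ hidealκ hκ)
  obtain ⟨K, hK⟩ := hS.eventually_modulus_orbit_le_rpow hu hdiff_w hbounded one_half_pos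
  obtain ⟨-, hdom, hAv₀⟩ := hv₀
  exact eventually_modulus_eigenvector_sub_le hu hdiff hS (v₀ := ⟨v₀, hdom⟩) hvec hlam heig hAv₀
    one_half_lt_one hK hε

theorem eventually_exists_real_eigenpair {S : C0Semigroup (LatticeCplx F)} {u : F} {l₀ c r : ℝ}
    (hR : IsResolventAt S.generator μ₀ R) (hμ₀ : μ₀ ≠ l₀) (hu : 0 ≤ u)
    (hdiff : S.ImmediatelyDifferentiable) (hS : Ultracontractive S u)
    (hpole : IsPoleOfResolvent S.generator l₀) (hsimple : IsAlgSimple S.generator l₀)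
    (hv₀ : IsEigenvector S.generator l₀ v₀) (hc : 0 < c) (hv₀u : ofReal (c • u) ≤ v₀) (hr : 0 < r)
    (hres : ∀ x ∈ Icc (l₀ - r) (l₀ + r), x ≠ l₀ → (x : ℂ) ∈ resolventSet S.generator)
    {b : ℂ → LatticeCplx F →L[ℂ] LatticeCplx F} (hb : ∀ᶠ κ in 𝓝 0, DifferentiableAt ℂ b κ)
    (hb₀ : b 0 = 0) (hadm : ∀ᶠ κ in 𝓝 0, S.Admissible (relPerturbation S.generator μ₀ (b κ)))
    (hideal : ∀ᶠ κ in 𝓝 0, IdealBounds S (relPerturbation S.generator μ₀ (b κ)) u) :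
    ∀ᶠ κ in 𝓝 0, IsRealOp (perturb S.generator (relPerturbation S.generator μ₀ (b κ))) →
      ∃ l ∈ Ioo (l₀ - r) (l₀ + r),
        IsAlgSimple (perturb S.generator (relPerturbation S.generator μ₀ (b κ))) l ∧
        (∀ x ∈ Ioo (l₀ - r) (l₀ + r),
          IsEigenvalue (perturb S.generator (relPerturbation S.generator μ₀ (b κ))) x → x = l) ∧
        ∃ v ∈ principalIdeal u,
          IsEigenvector (perturb S.generator (relPerturbation S.generator μ₀ (b κ))) l v ∧
          ofReal ((c / 2) • u) ≤ v := by
  obtain ⟨y, lam, hbranch⟩ := exists_isEigenBranch hR hμ₀ hpole hsimple hv₀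
  have hunique := hbranch.eventually_forall_mem_eq hR
    ((isCompact_Icc (a := l₀ - r) (b := l₀ + r)).image Complex.continuous_ofReal) <| by
      rintro _ ⟨⟨x, hx, rfl⟩, hne⟩
      exact hres x hx fun h => hne (congrArg _ h)
  have hbranch_near := (hbranch.eventually_isAlgSimple.and hbranch.eventually_isEigenvector).and
    ((hbranch.eventually_exists_ofReal_eq hr).and hunique)
  have hb_tendsto : Tendsto b (𝓝 0) (𝓝 0) := hb₀ ▸ hb.self_of_nhds.continuousAt.tendsto
  filter_upwards [hb_tendsto.eventually hbranch_near, hbranch.eventually_modulus_sub_le hR hu hdiff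
    hS hv₀ hb hb₀ hadm hideal (half_pos hc)] with κ ⟨⟨halg, heig⟩, hexists, hunique⟩ hclose hreal
  obtain ⟨l, hl, hlam⟩ := hexists hreal
  rw [hlam] at halg heig hunique
  exact ⟨l, hl, halg,
    fun x hx hxe => Complex.ofReal_inj.1 (hunique x ⟨x, Ioo_subset_Icc_self hx, rfl⟩ hxe),
    hreal.exists_isEigenvector_ge hu hc hv₀.1 hv₀u
      (eigenvector_generator_mem_principalIdeal hu hdiff hS hv₀) heig hclose⟩

end UnboundedOp

theorem mainTheorem4_general
    {F : Type*} [NormedAddCommGroup F] [Lattice F] [HasSolidNorm F] [IsOrderedAddMonoid F]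
    [NormedSpace ℝ F] [IsOrderedModule ℝ F] [CompleteSpace F]
    (u : F) (hu : 0 ≤ u)
    (S : C0Semigroup (LatticeCplx F))
    (hdiff : S.ImmediatelyDifferentiable)
    (B : ℂ → S.generator.domain →ₗ[ℂ] LatticeCplx F)
    (hB0 : B 0 = 0)
    (hBbdd : ∀ κ ∈ Metric.ball (0 : ℂ) 1, S.GraphBounded (B κ))
    (hS1 : LatticeCplx.Ultracontractive S u)
    (hS2 : ∀ κ ∈ Metric.ball (0 : ℂ) 1, S.Admissible (B κ))
    (hS3 : ∀ κ ∈ Metric.ball (0 : ℂ) 1, LatticeCplx.IdealBounds S (B κ) u)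
    (hhol : ∀ x : S.generator.domain,
      DifferentiableOn ℂ (fun κ => S.generator x + B κ x) (Metric.ball 0 1))
    (hAreal : LatticeCplx.IsRealOp S.generator)
    (hBreal : ∀ κ : ℝ, |κ| < 1 → LatticeCplx.IsRealOp (UnboundedOp.onDomain S.generator (B κ)))
    (l₀ : ℝ)
    (hpole : UnboundedOp.IsPoleOfResolvent S.generator l₀)
    (hsimple : UnboundedOp.IsAlgSimple S.generator l₀)
    (v₀ : LatticeCplx F) (hv₀ : UnboundedOp.IsEigenvector S.generator l₀ v₀)
    (c : ℝ) (hc : 0 < c) (hv₀u : LatticeCplx.ofReal (c • u) ≤ v₀)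
    (r : ℝ) (hr : 0 < r)
    (hisol : ∀ μ ∈ Set.Ioo (l₀ - r) (l₀ + r),
      ((μ : ℂ) ∈ UnboundedOp.spectrum S.generator ↔ μ = l₀))
    (hend : ∀ μ : ℝ, |μ - l₀| = r → (μ : ℂ) ∈ UnboundedOp.resolventSet S.generator) :
    ∃ δ : ℝ, 0 < δ ∧ δ ≤ 1 ∧ ∀ κ ∈ Set.Ioo (-δ) δ,
      ∃ l ∈ Set.Ioo (l₀ - r) (l₀ + r),
        UnboundedOp.IsAlgSimple (UnboundedOp.perturb S.generator (B κ)) l ∧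
        (∀ μ ∈ Set.Ioo (l₀ - r) (l₀ + r),
          UnboundedOp.IsEigenvalue (UnboundedOp.perturb S.generator (B κ)) μ → μ = l) ∧
        ∃ v ∈ LatticeCplx.principalIdeal u,
          UnboundedOp.IsEigenvector (UnboundedOp.perturb S.generator (B κ)) l v ∧
          LatticeCplx.ofReal ((c / 2) • u) ≤ v := by
  have hμ₀ : ((l₀ + r : ℝ) : ℂ) ∈ UnboundedOp.resolventSet S.generator :=
    hend _ (by rw [add_sub_cancel_left, abs_of_pos hr])
  have hR := UnboundedOp.isResolventAt_resolvent hμ₀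
  have hres : ∀ x ∈ Icc (l₀ - r) (l₀ + r), x ≠ l₀ →
      (x : ℂ) ∈ UnboundedOp.resolventSet S.generator :=
    fun x hx hne => (abs_sub_le_iff.2 ⟨by linarith [hx.2], by linarith [hx.1]⟩).eq_or_lt.elim
      (hend x) fun h => not_not.1 fun hx' => hne ((hisol x (by rwa [← Real.ball_eq_Ioo])).1 hx')
  obtain ⟨b, hb, hBb⟩ := UnboundedOp.exists_differentiableOn_eq_relPerturbation hR
    Metric.isOpen_ball hBbdd fun x => by simpa using (hhol x).sub_const (S.generator x)
  have hb₀ : b 0 = 0 := UnboundedOp.eq_zero_of_relPerturbation_eq_zero hR <| by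
    rw [← hBb 0 (Metric.mem_ball_self one_pos), hB0]
  have hball : Metric.ball (0 : ℂ) 1 ∈ 𝓝 0 := Metric.ball_mem_nhds 0 one_pos
  obtain ⟨δ, hδ, hpair⟩ := Metric.eventually_nhds_iff_ball.1 <|
    UnboundedOp.eventually_exists_real_eigenpair hR (by simpa using hr.ne') hu hdiff hS1 hpole
      hsimple hv₀ hc hv₀u hr hres (hb.eventually_differentiableAt hball) hb₀
      (eventually_of_mem hball fun κ hκ => hBb κ hκ ▸ hS2 κ hκ)
      (eventually_of_mem hball fun κ hκ => hBb κ hκ ▸ hS3 κ hκ)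
  refine ⟨min δ 1, lt_min hδ one_pos, min_le_right _ _, fun κ hκ => ?_⟩
  obtain ⟨hκδ, hκ1⟩ := lt_min_iff.1 (abs_lt.2 hκ)
  have hpair := hpair κ (by simpa using hκδ)
  rw [← hBb κ (by simpa using hκ1)] at hpair
  exact hpair (hAreal.perturb (hBreal κ hκ1))

theorem mainTheorem4
    {F : Type*} [NormedAddCommGroup F] [Lattice F] [HasSolidNorm F] [IsOrderedAddMonoid F]
    [NormedSpace ℝ F] [IsOrderedModule ℝ F] [CompleteSpace F]
    (u : F) (hu : 0 ≤ u)
    (S : C0Semigroup (LatticeCplx F))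
    (hdiff : S.ImmediatelyDifferentiable)
    (B : ℂ → S.generator.domain →ₗ[ℂ] LatticeCplx F)
    (hB0 : B 0 = 0)
    (hBbdd : ∀ κ ∈ Metric.ball (0 : ℂ) 1, S.GraphBounded (B κ))
    (hS1 : LatticeCplx.Ultracontractive S u)
    (hS2 : ∀ κ ∈ Metric.ball (0 : ℂ) 1, S.Admissible (B κ))
    (hS3 : ∀ κ ∈ Metric.ball (0 : ℂ) 1, LatticeCplx.IdealBounds S (B κ) u)
    (hhol : ∀ x : S.generator.domain,
      DifferentiableOn ℂ (fun κ => S.generator x + B κ x) (Metric.ball 0 1))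
    (hAreal : LatticeCplx.IsRealOp S.generator)
    (hBreal : ∀ κ : ℝ, |κ| < 1 → LatticeCplx.IsRealOp (UnboundedOp.onDomain S.generator (B κ)))
    (l₀ : ℝ)
    (hpole : UnboundedOp.IsPoleOfResolvent S.generator l₀)
    (hsimple : UnboundedOp.IsAlgSimple S.generator l₀)
    (v₀ : LatticeCplx F) (hv₀ : UnboundedOp.IsEigenvector S.generator l₀ v₀)
    (c : ℝ) (hc : 0 < c) (hv₀u : LatticeCplx.ofReal (c • u) ≤ v₀)
    (r : ℝ) (hr : 0 < r)
    (hisol : ∀ μ ∈ Set.Ioo (l₀ - r) (l₀ + r),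
      ((μ : ℂ) ∈ UnboundedOp.spectrum S.generator ↔ μ = l₀))
    (hend : ∀ μ : ℝ, |μ - l₀| = r → (μ : ℂ) ∈ UnboundedOp.resolventSet S.generator)
    (hβ : Filter.Tendsto (fun κ : ℝ => UnboundedOp.betaSup (B κ) l₀ r) (nhds 0) (nhds 0)) :
    ∃ δ : ℝ, 0 < δ ∧ δ ≤ 1 ∧ ∀ κ ∈ Set.Ioo (-δ) δ,
      ∃ l ∈ Set.Ioo (l₀ - r) (l₀ + r),
        UnboundedOp.IsAlgSimple (UnboundedOp.perturb S.generator (B κ)) l ∧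
        (∀ μ ∈ Set.Ioo (l₀ - r) (l₀ + r),
          UnboundedOp.IsEigenvalue (UnboundedOp.perturb S.generator (B κ)) μ → μ = l) ∧
        ∃ v ∈ LatticeCplx.principalIdeal u,
          UnboundedOp.IsEigenvector (UnboundedOp.perturb S.generator (B κ)) l v ∧
          LatticeCplx.ofReal ((c / 2) • u) ≤ v := by
  exact mainTheorem4_general u hu S hdiff B hB0 hBbdd hS1 hS2 hS3 hhol hAreal hBreal l₀ hpole
    hsimple v₀ hv₀ c hc hv₀u r hr hisol hend
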